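/- Let $I=[a,b]\subset\mathbb R$ with $a<b$, and let $f:I\to\mathbb R$ be twice continuously differentiable (one-sidedly at the endpoints) with $f''(x)\neq 0$ for all $x\in I$. Let $0<\phi<1$ and suppose $f''\in\mathrm{Lip}_\phi(I)$, i.e. there is a constant $K$ with $|f''(x)-f''(y)|\le K|x-y|^{\phi}$ for all $x,y\in I$. For $\boldsymbol\theta=(\theta_1,\theta_2)\in\mathbb R^2$, real $Q\ge 1$ and $\delta>0$ put $$N_{\boldsymbol\theta}(Q,\delta):=\#\Big\{(p,q)\in\mathbb Z\times\mathbb N:\ Q<q\le 2Q,\ \tfrac{p+\theta_1}{q}\in I,\ \big\|q f\big(\tfrac{p+\theta_1}{q}\big)-\theta_2\big\|<\delta\Big\},$$ where $\mathbb N=\{1,2,\dots\}$ and $\|x\|$ denotes the distance from $x$ to the nearest integer. Then for every $\varepsilon>0$ there is a constant $C>0$, depending only on $I,f,\phi,\varepsilon$, such that for all $\boldsymbol\theta\in\mathbb R^2$, all real $Q\ge 1$ and all $0<\delta\le\frac12$, $$N_{\boldsymbol\theta}(Q,\delta)\ \le\ C\left(\delta Q^2+\delta^{-\frac12}Q^{\frac12+\varepsilon}+\delta^{\frac{\phi-1}{2}}Q^{\frac{3-\phi}{2}}\right).$$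 -/

import Mathlib

open Set
open scoped NNReal

/-- The distance from a real number to the nearest integer. -/
noncomputable def distNearestInt (x : ℝ) : ℝ := |x - (round x : ℝ)|

/-- The pairs `(p, q)` of an integer `p` and a positive integer `q` with `Q < q ≤ 2Q`, such that
`(p + θ₁) / q` lies in `I` and `q f((p + θ₁) / q) - θ₂` has distance less than `δ`
from the nearest integer. -/
def shiftedRationals (f : ℝ → ℝ) (I : Set ℝ) (θ : ℝ × ℝ) (Q δ : ℝ) : Set (ℤ × ℕ) :=
  {z | 0 < z.2 ∧ Q < (z.2 : ℝ) ∧ (z.2 : ℝ) ≤ 2 * Q ∧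
    ((z.1 : ℝ) + θ.1) / (z.2 : ℝ) ∈ I ∧
    distNearestInt ((z.2 : ℝ) * f (((z.1 : ℝ) + θ.1) / (z.2 : ℝ)) - θ.2) < δ}

/-- The counted set is finite over a bounded interval, so that its `ncard` is its cardinality. -/
theorem shiftedRationals_finite (f : ℝ → ℝ) (a b : ℝ) (θ : ℝ × ℝ) (Q δ : ℝ) :
    (shiftedRationals f (Icc a b) θ Q δ).Finite := by
  have hfin : ((Icc ⌊-(2 * Q * (|a| + |b|)) - θ.1⌋ ⌈2 * Q * (|a| + |b|) - θ.1⌉) ×ˢ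
      (Iic ⌊2 * Q⌋₊) : Set (ℤ × ℕ)).Finite :=
    (finite_Icc _ _).prod (finite_Iic _)
  refine hfin.subset ?_
  rintro ⟨p, q⟩ ⟨hq, -, hq2, ⟨ha, hb⟩, -⟩
  have hq0 : (0 : ℝ) < (q : ℝ) := by exact_mod_cast hq
  rw [le_div_iff₀ hq0] at ha
  rw [div_le_iff₀ hq0] at hb
  have h1 : (q : ℝ) * (|a| + |b|) ≤ 2 * Q * (|a| + |b|) := by gcongr
  have h2 : b * (q : ℝ) ≤ (q : ℝ) * (|a| + |b|) := by
    nlinarith [le_abs_self b, abs_nonneg a]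
  have h3 : -((q : ℝ) * (|a| + |b|)) ≤ a * (q : ℝ) := by
    nlinarith [neg_abs_le a, abs_nonneg b]
  refine ⟨⟨?_, ?_⟩, Nat.le_floor hq2⟩
  · have h4 : -(2 * Q * (|a| + |b|)) - θ.1 ≤ (p : ℝ) := by linarith
    exact_mod_cast (Int.floor_le _).trans h4
  · have h5 : (p : ℝ) ≤ 2 * Q * (|a| + |b|) - θ.1 := by linarith
    exact_mod_cast h5.trans (Int.le_ceil _)

/-- The counting function `N_θ(Q, δ)` of `f` over `I`. -/
noncomputable def shiftedCount (f : ℝ → ℝ) (I : Set ℝ) (θ : ℝ × ℝ) (Q δ : ℝ) : ℕ :=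
  (shiftedRationals f I θ Q δ).ncard

/-! On a cell of length `ℓ = √(δ/Q)` the curve leaves its tangent by `O(δ/Q)`, so the pairs counted
there lift to integer vectors in a translate of a box with sides of order `Q`, `X = √(δQ)`, `δ`.
Parseval modulo a large `N` (`card_le_mul_card_dual`) bounds their number by the volume times the
number of integer points of the dual box. Translations only turn phases, whence uniformity in `θ`.
Up to sign, the nonzero dual points have height `O(1/δ)` and lie very close to the graph of the
Legendre transform `F` (`dualBox_isNear`); one of height `d` occurs for `O(1/(δd))` cells. What
remains is to bound `∑ 1/d` over integer points near the dual curve.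

That sum over heights up to `Y` is `O(Y^α)` for every `α > 0` (`exists_sum_near_le`), by descent.
Two primitive points near a convex curve whose abscissae differ by less than `c/Q` span a line,
which is a primitive point of height below `4cQ` near the dual curve, with the same nearness
constant (`exists_dual_point`); a line of height `b ≤ Q` carries `O(Q/b)` points
(`card_on_line_le`). The class `UnifConvex Λ` is closed under duality, so the step iterates, losing
a fixed factor for a drop in height as large as desired (`exists_sum_prim_le`).

Summing over cells gives `δQ² + X³δ^(-1-α)`. For `δ ≥ Q^(-γ)` the first term dominates, and smaller
`δ` follow by monotonicity. With `γ` chosen where `δQ²` equals the last term of the theorem, the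
middle term is never needed. -/

/-! ### Uniformly convex functions and Legendre duality. -/

/-- `f` is a convex function on the line with derivative (a choice of slopes) `g`, where `g` is
strictly increasing and bi-Lipschitz with constant `Λ`. -/
structure UnifConvex (Λ : ℝ) (f g : ℝ → ℝ) : Prop where
  one_le : 1 ≤ Λ
  subgrad : ∀ x y, f x + g x * (y - x) ≤ f y
  lower : ∀ x y, x ≤ y → y - x ≤ Λ * (g y - g x)
  upper : ∀ x y, x ≤ y → g y - g x ≤ Λ * (y - x)

namespace UnifConvex

variable {Λ : ℝ} {f g : ℝ → ℝ}

theorem pos (h : UnifConvex Λ f g) : 0 < Λ := one_pos.trans_le h.one_le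

theorem mono (h : UnifConvex Λ f g) {x y : ℝ} (hxy : x ≤ y) : g x ≤ g y := by
  have := h.lower x y hxy
  have := h.pos
  by_contra! hc
  nlinarith

theorem abs_sub_le_slope (h : UnifConvex Λ f g) (x y : ℝ) : |x - y| ≤ Λ * |g x - g y| := by
  rcases le_total x y with hxy | hxy
  · rw [abs_sub_comm x y, abs_sub_comm (g x), abs_of_nonneg (sub_nonneg.2 hxy),
      abs_of_nonneg (sub_nonneg.2 (h.mono hxy))]
    exact h.lower _ _ hxy
  · rw [abs_of_nonneg (sub_nonneg.2 hxy), abs_of_nonneg (sub_nonneg.2 (h.mono hxy))]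
    exact h.lower _ _ hxy

theorem abs_slope_le (h : UnifConvex Λ f g) (x y : ℝ) : |g x - g y| ≤ Λ * |x - y| := by
  rcases le_total x y with hxy | hxy
  · rw [abs_sub_comm x y, abs_sub_comm (g x), abs_of_nonneg (sub_nonneg.2 hxy),
      abs_of_nonneg (sub_nonneg.2 (h.mono hxy))]
    exact h.upper _ _ hxy
  · rw [abs_of_nonneg (sub_nonneg.2 hxy), abs_of_nonneg (sub_nonneg.2 (h.mono hxy))]
    exact h.upper _ _ hxy

theorem le_quadratic (h : UnifConvex Λ f g) (x y : ℝ) :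
    f y ≤ f x + g x * (y - x) + Λ * (y - x) ^ 2 := by
  have h1 := h.subgrad y x
  have h2 : (g y - g x) * (y - x) ≤ Λ * (y - x) ^ 2 := by
    rcases le_total x y with hxy | hxy
    · have := h.upper x y hxy
      nlinarith
    · have := h.upper y x hxy
      nlinarith
  nlinarith

theorem quadratic_le (h : UnifConvex Λ f g) (x y : ℝ) :
    f x + g x * (y - x) + (y - x) ^ 2 / (4 * Λ) ≤ f y := by
  have hΛ := h.pos
  have h1 := h.subgrad x ((x + y) / 2)
  have h2 := h.subgrad ((x + y) / 2) y
  have h3 : (y - x) ^ 2 / (4 * Λ) ≤ (g ((x + y) / 2) - g x) * ((y - x) / 2) := by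
    rw [div_le_iff₀ (by positivity)]
    rcases le_total x y with hxy | hxy
    · have := h.lower x ((x + y) / 2) (by linarith)
      nlinarith
    · have := h.lower ((x + y) / 2) x (by linarith)
      nlinarith
  nlinarith

/-- `lower` makes `g` unbounded in both directions and `upper` makes it continuous. Surjectivity is
what defines the Legendre transform on the whole line. -/
theorem surjective (h : UnifConvex Λ f g) : Function.Surjective g := by
  have hΛ := h.pos
  have hc : Continuous g := by
    refine (LipschitzWith.of_dist_le_mul (K := Λ.toNNReal) fun x y => ?_).continuous
    rw [Real.dist_eq, Real.dist_eq, Real.coe_toNNReal _ hΛ.le]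
    exact h.abs_slope_le x y
  intro y
  have h1 := h.lower 0 (Λ * |y - g 0|) (by positivity)
  have h2 := h.lower (-(Λ * |y - g 0|)) 0 (by simp; positivity)
  have h1' : y ≤ g (Λ * |y - g 0|) := by
    have : |y - g 0| ≤ g (Λ * |y - g 0|) - g 0 := by
      refine le_of_mul_le_mul_left ?_ hΛ; linarith
    linarith [le_abs_self (y - g 0)]
  have h2' : g (-(Λ * |y - g 0|)) ≤ y := by
    have : |y - g 0| ≤ g 0 - g (-(Λ * |y - g 0|)) := by
      refine le_of_mul_le_mul_left ?_ hΛ; linarith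
    linarith [neg_abs_le (y - g 0)]
  have := mem_range_of_exists_le_of_exists_ge hc ⟨_, h2'⟩ ⟨_, h1'⟩
  exact this

/-- The Legendre transform stays in the class, with the same constant. -/
theorem exists_dual (h : UnifConvex Λ f g) : ∃ F G : ℝ → ℝ, UnifConvex Λ F G ∧
    (∀ y, g (G y) = y) ∧ ∀ y, F y = y * G y - f (G y) := by
  obtain ⟨G, hG⟩ := h.surjective.hasRightInverse
  have hG' : ∀ y, g (G y) = y := hG
  have hmono : ∀ x y, x ≤ y → G x ≤ G y := by
    intro x y hxy
    by_contra! hc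
    have h1 := h.lower _ _ hc.le
    rw [hG', hG'] at h1
    nlinarith [h.pos]
  -- The subgradient inequality for the transform is that of `f` with the two points exchanged; as
  -- `G` inverts `g`, the bounds `lower` and `upper` trade places.
  refine ⟨fun y => y * G y - f (G y), G, ⟨h.one_le, fun x y => ?_, fun x y hxy => ?_,
    fun x y hxy => ?_⟩, hG', fun _ => rfl⟩
  · have := h.subgrad (G y) (G x)
    rw [hG'] at this
    linarith
  · have := h.upper _ _ (hmono x y hxy)
    rwa [hG', hG'] at this
  · have := h.lower _ _ (hmono x y hxy)
    rwa [hG', hG'] at this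

end UnifConvex

/-! ### Integer points near a convex curve and the lines joining them. -/

/-- Pigeonhole: measured from the leftmost point, the indices `⌊(x i - x m) / s⌋₊` are distinct. -/
theorem card_le_of_separated {ι : Type*} (T : Finset ι) (x : ι → ℝ) {s w : ℝ} (hs : 0 < s)
    (hw : 0 ≤ w) (hsep : ∀ i ∈ T, ∀ j ∈ T, i ≠ j → s ≤ |x i - x j|)
    (hdiam : ∀ i ∈ T, ∀ j ∈ T, |x i - x j| ≤ w) : (T.card : ℝ) ≤ w / s + 1 := by
  rcases T.eq_empty_or_nonempty with rfl | hT
  · simp; positivity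
  obtain ⟨m, hm, hmin⟩ := T.exists_min_image x hT
  have hnn : ∀ i ∈ T, 0 ≤ (x i - x m) / s := fun i hi =>
    div_nonneg (sub_nonneg.2 (hmin i hi)) hs.le
  have hcard : T.card ≤ (Finset.range (⌊w / s⌋₊ + 1)).card := by
    refine Finset.card_le_card_of_injOn (fun i => ⌊(x i - x m) / s⌋₊) (fun i hi => ?_)
      (fun i hi j hj hij => ?_)
    · have : ⌊(x i - x m) / s⌋₊ ≤ ⌊w / s⌋₊ := by
        apply Nat.floor_le_floor
        gcongr
        exact (le_abs_self _).trans (hdiam i hi m hm)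
      simpa using Nat.lt_succ_of_le this
    · by_contra hne
      have h1 := hsep i hi j hj hne
      have hij' : (⌊(x i - x m) / s⌋₊ : ℝ) = ⌊(x j - x m) / s⌋₊ := by exact_mod_cast hij
      have a1 := Nat.floor_le (hnn i hi)
      have a2 := Nat.lt_floor_add_one ((x i - x m) / s)
      have a3 := Nat.floor_le (hnn j hj)
      have a4 := Nat.lt_floor_add_one ((x j - x m) / s)
      have h2 : |(x i - x m) / s - (x j - x m) / s| < 1 := by
        rw [abs_lt]; constructor <;> linarith
      rw [← sub_div, sub_sub_sub_cancel_right, abs_div, abs_of_pos hs, div_lt_one hs] at h2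
      linarith
  rw [Finset.card_range] at hcard
  calc (T.card : ℝ) ≤ ((⌊w / s⌋₊ + 1 : ℕ) : ℝ) := by exact_mod_cast hcard
    _ ≤ w / s + 1 := by
        push_cast
        have := Nat.floor_le (div_nonneg hw hs.le)
        linarith

/-- An integer vector whose coordinates are jointly coprime. -/
def IsPrim (P : ℤ × ℤ × ℤ) : Prop :=
  ∃ s : ℤ × ℤ × ℤ, s.1 * P.1 + s.2.1 * P.2.1 + s.2.2 * P.2.2 = 1

/-- The rational point `(p / q, r / q)` is within `κ / q ^ 2` of the graph of `f`. -/
def IsNear (κ : ℝ) (f : ℝ → ℝ) (P : ℤ × ℤ × ℤ) : Prop :=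
  0 < P.1 ∧ (P.1 : ℝ) * |(P.1 : ℝ) * f ((P.2.1 : ℝ) / P.1) - P.2.2| ≤ κ

/-- The point `P` lies on the line with homogeneous dual coordinates `b`. -/
def Incident (b P : ℤ × ℤ × ℤ) : Prop := b.1 * P.2.2 + b.2.2 * P.1 = b.2.1 * P.2.1

theorem exists_isPrim (v : ℤ × ℤ × ℤ) (hv : v ≠ 0) : ∃ m : ℤ, 0 < m ∧ ∃ a, IsPrim a ∧
    v.1 = m * a.1 ∧ v.2.1 = m * a.2.1 ∧ v.2.2 = m * a.2.2 := by
  obtain ⟨x, y, z⟩ := v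
  set e : ℕ := Int.gcd y z with he
  set d : ℕ := Int.gcd x e with hd
  have hd0 : d ≠ 0 := by
    intro h0
    rw [hd, Int.gcd_eq_zero_iff] at h0
    have h1 : e = 0 := by exact_mod_cast h0.2
    rw [he, Int.gcd_eq_zero_iff] at h1
    exact hv (by simp [h0.1, h1.1, h1.2])
  have hde : (d : ℤ) ∣ e := Int.gcd_dvd_right ..
  obtain ⟨a, ha⟩ : (d : ℤ) ∣ x := Int.gcd_dvd_left ..
  obtain ⟨b, hb⟩ : (d : ℤ) ∣ y := hde.trans (Int.gcd_dvd_left ..)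
  obtain ⟨c, hc⟩ : (d : ℤ) ∣ z := hde.trans (Int.gcd_dvd_right ..)
  refine ⟨d, by positivity, (a, b, c), ?_, ha, hb, hc⟩
  have h1 := Int.gcd_eq_gcd_ab y z
  have h2 := Int.gcd_eq_gcd_ab x e
  rw [← he] at h1
  rw [← hd] at h2
  refine ⟨(Int.gcdA x e, Int.gcdA y z * Int.gcdB x e, Int.gcdB y z * Int.gcdB x e), ?_⟩
  have hd0' : (d : ℤ) ≠ 0 := by exact_mod_cast hd0
  apply mul_left_cancel₀ hd0'
  simp only
  generalize Int.gcdA x e = u1 at *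
  generalize Int.gcdB x e = u2 at *
  generalize Int.gcdA y z = u3 at *
  generalize Int.gcdB y z = u4 at *
  linear_combination (-1 : ℤ) * h2 - u2 * h1 - u1 * ha - u2 * u3 * hb - u2 * u4 * hc

/-- An integer vector parallel to a primitive one is an integer multiple of it. -/
theorem IsPrim.exists_mul {a : ℤ × ℤ × ℤ} (ha : IsPrim a) (v : ℤ × ℤ × ℤ)
    (h1 : v.1 * a.2.1 = v.2.1 * a.1) (h2 : v.1 * a.2.2 = v.2.2 * a.1)
    (h3 : v.2.1 * a.2.2 = v.2.2 * a.2.1) :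
    ∃ m : ℤ, v.1 = m * a.1 ∧ v.2.1 = m * a.2.1 ∧ v.2.2 = m * a.2.2 := by
  obtain ⟨s, hs⟩ := ha
  refine ⟨s.1 * v.1 + s.2.1 * v.2.1 + s.2.2 * v.2.2, ?_, ?_, ?_⟩
  · linear_combination (-v.1) * hs + s.2.1 * h1 + s.2.2 * h2
  · linear_combination (-v.2.1) * hs - s.1 * h1 + s.2.2 * h3
  · linear_combination (-v.2.2) * hs - s.1 * h2 - s.2.1 * h3

theorem IsPrim.eq_of_parallel {P R : ℤ × ℤ × ℤ} (hP : IsPrim P) (hR : IsPrim R)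
    (hP0 : 0 < P.1) (hR0 : 0 < R.1) (h1 : P.1 * R.2.1 = P.2.1 * R.1)
    (h2 : P.1 * R.2.2 = P.2.2 * R.1) (h3 : P.2.1 * R.2.2 = P.2.2 * R.2.1) : P = R := by
  obtain ⟨m, m1, m2, m3⟩ := hR.exists_mul P h1 h2 h3
  obtain ⟨n, n1, n2, n3⟩ := hP.exists_mul R (by linarith) (by linarith) (by linarith)
  have hm : 0 < m := by
    by_contra! hc
    nlinarith
  have hn : 0 < n := by
    by_contra! hc
    nlinarith
  have hmn : m * n = 1 := by
    rw [n1] at m1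
    have : P.1 * (m * n - 1) = 0 := by linarith
    rcases mul_eq_zero.1 this with h | h <;> linarith
  have : m = 1 := by
    rcases Int.eq_one_or_neg_one_of_mul_eq_one hmn with h | h <;> linarith
  subst this
  ext <;> linarith

theorem IsNear.abs_sub_le {κ Q : ℝ} {f : ℝ → ℝ} {P : ℤ × ℤ × ℤ} (h : IsNear κ f P) (hQ : 0 < Q)
    (hP : Q ≤ P.1) : |f ((P.2.1 : ℝ) / P.1) - (P.2.2 : ℝ) / P.1| ≤ κ / Q ^ 2 := by
  have hq : (0 : ℝ) < P.1 := hQ.trans_le hP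
  have h1 : (P.1 : ℝ) * f ((P.2.1 : ℝ) / P.1) - P.2.2 =
      P.1 * (f ((P.2.1 : ℝ) / P.1) - (P.2.2 : ℝ) / P.1) := by field_simp
  have h2 := h.2
  rw [h1, abs_mul, abs_of_pos hq] at h2
  rw [le_div_iff₀ (by positivity)]
  have h3 : Q ^ 2 ≤ (P.1 : ℝ) ^ 2 := by gcongr
  nlinarith [abs_nonneg (f ((P.2.1 : ℝ) / P.1) - (P.2.2 : ℝ) / P.1)]

/-- Two distinct primitive points close to the same graph have distinct abscissae. -/
theorem abscissa_ne {κ Q : ℝ} {f : ℝ → ℝ} {P R : ℤ × ℤ × ℤ} (hP : IsPrim P) (hR : IsPrim R)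
    (hPn : IsNear κ f P) (hRn : IsNear κ f R) (hQ : 0 < Q) (hκ : 0 ≤ κ) (hκ8 : κ < 1 / 8)
    (hPQ : Q ≤ P.1) (hPQ' : (P.1 : ℝ) < 2 * Q) (hRQ : Q ≤ R.1) (hRQ' : (R.1 : ℝ) < 2 * Q)
    (hne : P ≠ R) : (P.2.1 : ℝ) / P.1 ≠ (R.2.1 : ℝ) / R.1 := by
  intro hx
  apply hne
  have hp : (0 : ℝ) < P.1 := hQ.trans_le hPQ
  have hr : (0 : ℝ) < R.1 := hQ.trans_le hRQ
  have e1 := hPn.abs_sub_le hQ hPQ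
  have e2 := hRn.abs_sub_le hQ hRQ
  rw [hx] at e1
  have e3 : |(P.2.2 : ℝ) / P.1 - (R.2.2 : ℝ) / R.1| ≤ 2 * (κ / Q ^ 2) := by
    have := abs_sub_le ((P.2.2 : ℝ) / P.1) (f ((R.2.1 : ℝ) / R.1)) ((R.2.2 : ℝ) / R.1)
    rw [abs_sub_comm ((P.2.2 : ℝ) / P.1) (f _)] at this
    linarith
  -- With equal abscissae the ordinates differ by at most `2κ/Q²`, so this integer determinant is at
  -- most `8κ < 1` and vanishes.
  have e4 : |((P.2.2 * R.1 - P.1 * R.2.2 : ℤ) : ℝ)| < 1 := by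
    have e5 : ((P.2.2 * R.1 - P.1 * R.2.2 : ℤ) : ℝ) =
        ((P.2.2 : ℝ) / P.1 - (R.2.2 : ℝ) / R.1) * (P.1 * R.1) := by
      push_cast; field_simp
    rw [e5, abs_mul, abs_of_pos (mul_pos hp hr)]
    have e6 : (P.1 : ℝ) * R.1 ≤ 4 * Q ^ 2 := by nlinarith
    calc _ ≤ 2 * (κ / Q ^ 2) * (4 * Q ^ 2) := by gcongr
      _ = 8 * κ := by field_simp; ring
      _ < 1 := by linarith
  have e7 : P.1 * R.2.2 = P.2.2 * R.1 := by
    have : P.2.2 * R.1 - P.1 * R.2.2 = 0 := Int.abs_lt_one_iff.1 (by exact_mod_cast e4)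
    linarith
  have e8 : P.1 * R.2.1 = P.2.1 * R.1 := by
    rw [div_eq_div_iff hp.ne' hr.ne'] at hx
    have : P.2.1 * R.1 = R.2.1 * P.1 := by exact_mod_cast hx
    linarith
  refine hP.eq_of_parallel hR hPn.1 hRn.1 e8 e7 ?_
  have : P.1 * (P.2.1 * R.2.2 - P.2.2 * R.2.1) = 0 := by
    linear_combination P.2.1 * e7 - P.2.2 * e8
  rcases mul_eq_zero.1 this with h | h
  · exact absurd h hPn.1.ne'
  · linarith

/-- Distinct primitive points on a line are separated. -/
theorem line_separated {Q : ℝ} {b P R : ℤ × ℤ × ℤ} (hb : IsPrim b) (hb0 : 0 < b.1)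
    (hPb : Incident b P) (hRb : Incident b R) (hQ : 0 < Q)
    (hPQ : Q ≤ P.1) (hPQ' : (P.1 : ℝ) < 2 * Q) (hRQ : Q ≤ R.1) (hRQ' : (R.1 : ℝ) < 2 * Q)
    (hx : (P.2.1 : ℝ) / P.1 ≠ (R.2.1 : ℝ) / R.1) :
    (b.1 : ℝ) / (4 * Q ^ 2) ≤ |(P.2.1 : ℝ) / P.1 - (R.2.1 : ℝ) / R.1| := by
  have hp : (0 : ℝ) < P.1 := hQ.trans_le hPQ
  have hr : (0 : ℝ) < R.1 := hQ.trans_le hRQ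
  unfold Incident at hPb hRb
  -- The cross product of `P` and `R` is parallel to `b`, hence an integer multiple of it because
  -- `b` is primitive.
  obtain ⟨m, m1, -, -⟩ := hb.exists_mul (P.1 * R.2.1 - P.2.1 * R.1, P.1 * R.2.2 - P.2.2 * R.1,
    P.2.1 * R.2.2 - P.2.2 * R.2.1)
    (by simp only; linear_combination R.1 * hPb - P.1 * hRb)
    (by simp only; linear_combination R.2.1 * hPb - P.2.1 * hRb)
    (by simp only; linear_combination R.2.2 * hPb - P.2.2 * hRb)
  simp only at m1
  have e1 : (P.2.1 : ℝ) / P.1 - (R.2.1 : ℝ) / R.1 = -(m * b.1 : ℝ) / (P.1 * R.1) := by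
    have : (P.1 * R.2.1 - P.2.1 * R.1 : ℝ) = m * b.1 := by exact_mod_cast m1
    rw [← this]; field_simp; ring
  have hm : m ≠ 0 := by
    rintro rfl
    apply hx
    rw [← sub_eq_zero, e1]; simp
  have hm1 : (1 : ℝ) ≤ |(m : ℝ)| := by exact_mod_cast Int.one_le_abs hm
  have hb0' : (0 : ℝ) < b.1 := by exact_mod_cast hb0
  rw [e1, abs_div, abs_neg, abs_mul, abs_of_pos hb0', abs_of_pos (mul_pos hp hr)]
  have e6 : (P.1 : ℝ) * R.1 ≤ 4 * Q ^ 2 := by nlinarith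
  gcongr
  nlinarith

/-- The chord through two points near a uniformly convex curve is close to a tangent line. -/
theorem UnifConvex.dual_chord {Λ : ℝ} {f g F G : ℝ → ℝ} (h : UnifConvex Λ f g)
    (hG : ∀ y, g (G y) = y) (hF : ∀ y, F y = y * G y - f (G y)) {x₁ x₂ y₁ y₂ e σ : ℝ}
    (hx : x₁ < x₂) (h₁ : |f x₁ - y₁| ≤ e) (h₂ : |f x₂ - y₂| ≤ e)
    (hσ : y₂ - y₁ = σ * (x₂ - x₁)) :
    |F σ - (σ * x₁ - y₁)| ≤ e + Λ * (x₂ - x₁ + 2 * Λ * e / (x₂ - x₁)) ^ 2 ∧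
      g x₁ - 2 * e / (x₂ - x₁) ≤ σ ∧ σ ≤ g x₂ + 2 * e / (x₂ - x₁) := by
  have hΛ := h.pos
  have hd : 0 < x₂ - x₁ := sub_pos.2 hx
  have he : 0 ≤ e := (abs_nonneg _).trans h₁
  obtain ⟨a1, a2⟩ := abs_le.1 h₁
  obtain ⟨b1, b2⟩ := abs_le.1 h₂
  have s1 := h.subgrad x₁ x₂
  have s2 := h.subgrad x₂ x₁
  have hlo : g x₁ - 2 * e / (x₂ - x₁) ≤ σ := by
    rw [sub_le_iff_le_add, ← sub_le_iff_le_add', le_div_iff₀ hd]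
    linarith
  have hhi : σ ≤ g x₂ + 2 * e / (x₂ - x₁) := by
    rw [← sub_le_iff_le_add', le_div_iff₀ hd]
    linarith
  refine ⟨?_, hlo, hhi⟩
  have he' : 0 ≤ 2 * e / (x₂ - x₁) := by positivity
  have hE : 2 * Λ * e / (x₂ - x₁) = Λ * (2 * e / (x₂ - x₁)) := by ring
  rw [hE]
  set E := 2 * e / (x₂ - x₁) with hEdef
  -- The slope `σ` is within `E` of `[g x₁, g x₂]`, so the point of tangency `G σ` is within `Λ * E`
  -- of `[x₁, x₂]`.
  have hX1 : G σ - x₁ ≤ x₂ - x₁ + Λ * E := by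
    rcases le_total (G σ) x₂ with hc | hc
    · nlinarith
    · have := h.lower _ _ hc
      rw [hG] at this
      nlinarith
  have hX2 : -(x₂ - x₁ + Λ * E) ≤ G σ - x₁ := by
    rcases le_total x₁ (G σ) with hc | hc
    · nlinarith
    · have := h.lower _ _ hc
      rw [hG] at this
      nlinarith
  have hsq : (x₁ - G σ) ^ 2 ≤ (x₂ - x₁ + Λ * E) ^ 2 := by
    apply sq_le_sq'
    · linarith
    · linarith
  -- `F σ - (σ * x₁ - f x₁)` is the gap at `x₁` between `f` and its tangent of slope `σ`:
  -- nonnegative and at most quadratic.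
  have t1 := h.subgrad (G σ) x₁
  have t2 := h.le_quadratic (G σ) x₁
  rw [hG] at t1 t2
  have t3 := mul_le_mul_of_nonneg_left hsq hΛ.le
  rw [hF, abs_le]
  constructor <;> nlinarith

/-- This fixes the value of `κ`: the two parts contribute at most `κ/16` and `9κ/16`, so nearness
survives duality with the same constant, as iteration requires. -/
theorem dual_error_le {Λ κ Q d A : ℝ} (hΛ : 1 ≤ Λ) (hκ : κ = 1 / (256 * Λ ^ 3)) (hQ : 0 < Q)
    (hd : 0 < d) (hdQ : Q * d ≤ 1 / (16 * Λ)) (hA : 0 ≤ A) (hAd : A ≤ 4 * Q ^ 2 * d) :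
    A ^ 2 * (κ / Q ^ 2 + Λ * (d + 2 * Λ * (κ / Q ^ 2) / d) ^ 2) ≤ κ := by
  have hΛ0 : 0 < Λ := by linarith
  have hκ0 : 0 < κ := by rw [hκ]; positivity
  have hu : (Q * d) ^ 2 ≤ 1 / (256 * Λ ^ 2) := by
    calc (Q * d) ^ 2 ≤ (1 / (16 * Λ)) ^ 2 := by gcongr
      _ = _ := by field_simp; norm_num
  have h0 : 1 / (256 * Λ ^ 2) ≤ 1 / 256 := by
    apply one_div_le_one_div_of_le (by norm_num)
    nlinarith
  have h1 : A ^ 2 * (κ / Q ^ 2) ≤ κ / 16 := by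
    calc A ^ 2 * (κ / Q ^ 2) ≤ (4 * Q ^ 2 * d) ^ 2 * (κ / Q ^ 2) := by gcongr
      _ = 16 * (Q * d) ^ 2 * κ := by field_simp; norm_num
      _ ≤ 16 * (1 / 256) * κ := by gcongr; linarith
      _ = _ := by ring
  have h2 : A * (d + 2 * Λ * (κ / Q ^ 2) / d) ≤ 3 / (64 * Λ ^ 2) := by
    calc A * (d + 2 * Λ * (κ / Q ^ 2) / d)
        ≤ 4 * Q ^ 2 * d * (d + 2 * Λ * (κ / Q ^ 2) / d) := by gcongr
      _ = 4 * (Q * d) ^ 2 + 8 * Λ * κ := by field_simp; ring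
      _ ≤ 4 * (1 / (256 * Λ ^ 2)) + 8 * Λ * κ := by gcongr
      _ = _ := by rw [hκ]; field_simp; norm_num
  have h3 : A ^ 2 * (Λ * (d + 2 * Λ * (κ / Q ^ 2) / d) ^ 2) ≤ 9 / 16 * κ := by
    calc A ^ 2 * (Λ * (d + 2 * Λ * (κ / Q ^ 2) / d) ^ 2)
        = Λ * (A * (d + 2 * Λ * (κ / Q ^ 2) / d)) ^ 2 := by ring
      _ ≤ Λ * (3 / (64 * Λ ^ 2)) ^ 2 := by gcongr
      _ = _ := by rw [hκ]; field_simp; norm_num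
  rw [mul_add]
  linarith

/-- `b` is the primitive part of the cross product of `P` and `R`. Its height is bounded because
points on its line are `b.1 / (4 * Q ^ 2)` apart, and its nearness to `F` comes from the chord being
almost a tangent. -/
theorem exists_dual_point {Λ κ Q : ℝ} {f g F G : ℝ → ℝ} (h : UnifConvex Λ f g)
    (hG : ∀ y, g (G y) = y) (hF : ∀ y, F y = y * G y - f (G y)) (hκ : κ = 1 / (256 * Λ ^ 3))
    (hQ : 0 < Q) {P R : ℤ × ℤ × ℤ}
    (hPn : IsNear κ f P) (hRn : IsNear κ f R)
    (hPQ : Q ≤ P.1) (hPQ' : (P.1 : ℝ) < 2 * Q) (hRQ : Q ≤ R.1) (hRQ' : (R.1 : ℝ) < 2 * Q)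
    (hx : (P.2.1 : ℝ) / P.1 < (R.2.1 : ℝ) / R.1)
    (hd : Q * ((R.2.1 : ℝ) / R.1 - (P.2.1 : ℝ) / P.1) ≤ 1 / (16 * Λ)) :
    ∃ b, IsPrim b ∧ IsNear κ F b ∧ Incident b P ∧ Incident b R ∧
      (b.1 : ℝ) ≤ 4 * Q ^ 2 * ((R.2.1 : ℝ) / R.1 - (P.2.1 : ℝ) / P.1) ∧
      g ((P.2.1 : ℝ) / P.1) - 1 ≤ (b.2.1 : ℝ) / b.1 ∧
      (b.2.1 : ℝ) / b.1 ≤ g ((R.2.1 : ℝ) / R.1) + 1 := by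
  have hΛ := h.one_le
  have hκ0 : 0 < κ := by rw [hκ]; positivity
  have hκ8 : κ ≤ 1 / 256 := by
    rw [hκ]
    apply one_div_le_one_div_of_le (by norm_num)
    nlinarith [one_le_pow₀ hΛ (n := 3)]
  have hp : (0 : ℝ) < P.1 := hQ.trans_le hPQ
  have hr : (0 : ℝ) < R.1 := hQ.trans_le hRQ
  have hpz : 0 < P.1 := hPn.1
  have hrz : 0 < R.1 := hRn.1
  have hv1 : 0 < P.1 * R.2.1 - P.2.1 * R.1 := by
    rw [div_lt_div_iff₀ hp hr] at hx
    have : P.2.1 * R.1 < R.2.1 * P.1 := by exact_mod_cast hx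
    linarith
  obtain ⟨m, hm, b, hb, m1, m2, m3⟩ := exists_isPrim (P.1 * R.2.1 - P.2.1 * R.1,
    P.1 * R.2.2 - P.2.2 * R.1, P.2.1 * R.2.2 - P.2.2 * R.2.1)
    (by intro h0; simp only [Prod.mk_eq_zero] at h0; linarith [h0.1])
  simp only at m1 m2 m3
  have hb1 : 0 < b.1 := by
    by_contra! hc
    nlinarith
  have hb1' : (0 : ℝ) < b.1 := by exact_mod_cast hb1
  have iP : Incident b P := by
    have : m * (b.1 * P.2.2 + b.2.2 * P.1 - b.2.1 * P.2.1) = 0 := by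
      linear_combination -P.2.2 * m1 - P.1 * m3 + P.2.1 * m2
    rcases mul_eq_zero.1 this with h' | h'
    · exact absurd h' hm.ne'
    · unfold Incident; linarith
  have iR : Incident b R := by
    have : m * (b.1 * R.2.2 + b.2.2 * R.1 - b.2.1 * R.2.1) = 0 := by
      linear_combination -R.2.2 * m1 - R.1 * m3 + R.2.1 * m2
    rcases mul_eq_zero.1 this with h' | h'
    · exact absurd h' hm.ne'
    · unfold Incident; linarith
  have hdpos : 0 < (R.2.1 : ℝ) / R.1 - (P.2.1 : ℝ) / P.1 := sub_pos.2 hx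
  have hsep := line_separated hb hb1 iR iP hQ hRQ hRQ' hPQ hPQ' hx.ne'
  rw [abs_of_pos hdpos, div_le_iff₀ (by positivity)] at hsep
  have yP : (P.2.2 : ℝ) / P.1 = (b.2.1 / b.1 : ℝ) * (P.2.1 / P.1) - b.2.2 / b.1 := by
    have : (b.1 * P.2.2 + b.2.2 * P.1 : ℝ) = b.2.1 * P.2.1 := by exact_mod_cast iP
    field_simp; linarith
  have yR : (R.2.2 : ℝ) / R.1 = (b.2.1 / b.1 : ℝ) * (R.2.1 / R.1) - b.2.2 / b.1 := by
    have : (b.1 * R.2.2 + b.2.2 * R.1 : ℝ) = b.2.1 * R.2.1 := by exact_mod_cast iR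
    field_simp; linarith
  obtain ⟨c1, c2, c3⟩ := h.dual_chord hG hF hx (hPn.abs_sub_le hQ hPQ) (hRn.abs_sub_le hQ hRQ)
    (σ := (b.2.1 : ℝ) / b.1) (by rw [yP, yR]; ring)
  set d := (R.2.1 : ℝ) / R.1 - (P.2.1 : ℝ) / P.1 with hd_def
  have hAd : (b.1 : ℝ) ≤ 4 * Q ^ 2 * d := by linarith
  have hb1ge : (1 : ℝ) ≤ b.1 := by exact_mod_cast hb1
  have hE : 2 * (κ / Q ^ 2) / d ≤ 1 := by
    rw [← mul_div_assoc, div_div, div_le_one (by positivity)]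
    linarith
  refine ⟨b, hb, ⟨hb1, ?_⟩, iP, iR, hAd, by linarith, by linarith⟩
  have e1 := dual_error_le hΛ hκ hQ hdpos hd hb1'.le hAd
  have e2 : (b.1 : ℝ) * F ((b.2.1 : ℝ) / b.1) - b.2.2 =
      b.1 * (F ((b.2.1 : ℝ) / b.1) - ((b.2.1 : ℝ) / b.1 * (P.2.1 / P.1) - P.2.2 / P.1)) := by
    rw [yP]; field_simp; ring
  rw [e2, abs_mul, abs_of_pos hb1', ← mul_assoc, ← sq]
  exact (mul_le_mul_of_nonneg_left c1 (by positivity)).trans e1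

/-- A line carries few primitive points close to a uniformly convex curve. -/
theorem card_on_line_le {Λ κ Q : ℝ} {f g G : ℝ → ℝ} (h : UnifConvex Λ f g)
    (hG : ∀ y, g (G y) = y) (hκ : κ = 1 / (256 * Λ ^ 3)) (hQ : 0 < Q) {b : ℤ × ℤ × ℤ}
    (hb : IsPrim b) (hb0 : 0 < b.1) (hbQ : (b.1 : ℝ) ≤ Q) (T : Finset (ℤ × ℤ × ℤ))
    (hT : ∀ P ∈ T, IsPrim P ∧ IsNear κ f P ∧ Q ≤ P.1 ∧ (P.1 : ℝ) < 2 * Q ∧ Incident b P) :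
    (T.card : ℝ) ≤ 10 * Q / b.1 := by
  classical
  have hΛ := h.one_le
  have hκ0 : 0 < κ := by rw [hκ]; positivity
  have hκ8 : κ ≤ 1 / 256 := by
    rw [hκ]
    apply one_div_le_one_div_of_le (by norm_num)
    nlinarith [one_le_pow₀ hΛ (n := 3)]
  have hκΛ : 8 * Λ * κ ≤ 1 := by
    rw [hκ, mul_one_div, div_le_one (by positivity)]
    nlinarith [one_le_pow₀ hΛ (n := 2)]
  have hb0' : (0 : ℝ) < b.1 := by exact_mod_cast hb0
  set σ := (b.2.1 : ℝ) / b.1 with hσ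
  have hy : ∀ P ∈ T, (P.2.2 : ℝ) / P.1 = σ * (P.2.1 / P.1) - b.2.2 / b.1 := by
    intro P hP
    obtain ⟨-, hn, -, -, hi⟩ := hT P hP
    have hp : (0 : ℝ) < P.1 := by exact_mod_cast hn.1
    have : (b.1 * P.2.2 + b.2.2 * P.1 : ℝ) = b.2.1 * P.2.1 := by exact_mod_cast hi
    rw [hσ]; field_simp; linarith
  -- On one side of the tangency abscissa `G σ`, `f` minus the line is monotone with quadratic
  -- growth, yet it varies by at most `2κ/Q²`; hence the abscissae span at most `1/Q`.
  have hup : ∀ P ∈ T, ∀ R ∈ T, (P.2.1 : ℝ) / P.1 ≤ R.2.1 / R.1 →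
      (G σ ≤ P.2.1 / P.1 ∨ (R.2.1 : ℝ) / R.1 ≤ G σ) →
      (R.2.1 : ℝ) / R.1 - P.2.1 / P.1 ≤ 1 / Q := by
    intro P hP R hR hPR hside
    obtain ⟨-, hPn, hPQ, -, -⟩ := hT P hP
    obtain ⟨-, hRn, hRQ, -, -⟩ := hT R hR
    obtain ⟨a1, a2⟩ := abs_le.1 (hPn.abs_sub_le hQ hPQ)
    obtain ⟨b1, b2⟩ := abs_le.1 (hRn.abs_sub_le hQ hRQ)
    rw [hy P hP] at a1 a2
    rw [hy R hR] at b1 b2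
    set x := (P.2.1 : ℝ) / P.1
    set z := (R.2.1 : ℝ) / R.1
    have key : (z - x) ^ 2 / (4 * Λ) ≤ 2 * (κ / Q ^ 2) := by
      rcases hside with hs | hs
      · have q1 := h.quadratic_le x z
        have q2 := h.mono hs
        rw [hG] at q2
        nlinarith
      · have q1 := h.quadratic_le z x
        have q2 := h.mono hs
        rw [hG] at q2
        have q3 : (x - z) ^ 2 = (z - x) ^ 2 := by ring
        rw [q3] at q1
        nlinarith
    rw [div_le_iff₀ (by positivity)] at key
    have key2 : (z - x) ^ 2 ≤ (1 / Q) ^ 2 := by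
      refine key.trans ?_
      calc 2 * (κ / Q ^ 2) * (4 * Λ) = (8 * Λ * κ) * (1 / Q) ^ 2 := by ring
        _ ≤ 1 * (1 / Q) ^ 2 := by gcongr
        _ = _ := one_mul _
    exact le_of_sq_le_sq key2 (by positivity)
  have hside : ∀ T' ⊆ T, ((∀ P ∈ T', G σ ≤ (P.2.1 : ℝ) / P.1) ∨
      ∀ P ∈ T', (P.2.1 : ℝ) / P.1 ≤ G σ) → (T'.card : ℝ) ≤ 4 * Q / b.1 + 1 := by
    intro T' hT' hor
    have := card_le_of_separated T' (fun P => (P.2.1 : ℝ) / P.1)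
      (s := (b.1 : ℝ) / (4 * Q ^ 2)) (w := 1 / Q) (by positivity) (by positivity)
      (fun P hP R hR hne => ?_) (fun P hP R hR => ?_)
    · convert this using 2
      field_simp
    · obtain ⟨hp, hPn, hPQ, hPQ', hPi⟩ := hT P (hT' hP)
      obtain ⟨hr, hRn, hRQ, hRQ', hRi⟩ := hT R (hT' hR)
      exact line_separated hb hb0 hPi hRi hQ hPQ hPQ' hRQ hRQ'
        (abscissa_ne hp hr hPn hRn hQ hκ0.le (by linarith) hPQ hPQ' hRQ hRQ' hne)
    · rcases le_total ((P.2.1 : ℝ) / P.1) (R.2.1 / R.1) with hc | hc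
      · rw [abs_sub_comm, abs_of_nonneg (sub_nonneg.2 hc)]
        exact hup P (hT' hP) R (hT' hR) hc
          (hor.imp (fun ho => ho P hP) (fun ho => ho R hR))
      · rw [abs_of_nonneg (sub_nonneg.2 hc)]
        exact hup R (hT' hR) P (hT' hP) hc
          (hor.imp (fun ho => ho R hR) (fun ho => ho P hP))
  have c1 := hside (T.filter fun P => G σ ≤ (P.2.1 : ℝ) / P.1) (Finset.filter_subset _ _)
    (Or.inl fun P hP => (Finset.mem_filter.1 hP).2)
  have c2 := hside (T.filter fun P => ¬ G σ ≤ (P.2.1 : ℝ) / P.1) (Finset.filter_subset _ _)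
    (Or.inr fun P hP => (not_le.1 (Finset.mem_filter.1 hP).2).le)
  have c3 := Finset.card_filter_add_card_filter_not (s := T) fun P => G σ ≤ (P.2.1 : ℝ) / P.1
  have c4 : (T.card : ℝ) ≤ 8 * Q / b.1 + 2 := by
    rw [← c3]; push_cast
    have : 8 * Q / (b.1 : ℝ) = 4 * Q / b.1 + 4 * Q / b.1 := by ring
    linarith
  -- The hypothesis `b.1 ≤ Q` absorbs the additive `2` left by the two sides, turning `8` into `10`.
  have c5 : (1 : ℝ) ≤ Q / b.1 := by rwa [one_le_div hb0']
  have : 10 * Q / (b.1 : ℝ) = 8 * Q / b.1 + 2 * (Q / b.1) := by ring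
  linarith

/-! ### Descent to the dual curve and the weighted count of points. -/

/-- Duality replaces an interval of abscissae by a longer interval of slopes; peeling off one unit
interval at a time brings it back to unit length. -/
theorem sum_le_of_unit_intervals {ι : Type*} (x w : ι → ℝ) (B : ℝ) (n : ℕ) :
    ∀ (t : ℝ) (S : Finset ι), (∀ i ∈ S, t ≤ x i ∧ x i ≤ t + (n + 1)) →
      (∀ τ, ∀ T ⊆ S, (∀ i ∈ T, τ ≤ x i ∧ x i ≤ τ + 1) → ∑ i ∈ T, w i ≤ B) →
      ∑ i ∈ S, w i ≤ (n + 1) * B := by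
  classical
  induction n with
  | zero =>
    intro t S hS hB
    simpa using hB t S subset_rfl (by simpa using hS)
  | succ n ih =>
    intro t S hS hB
    rw [← Finset.sum_filter_add_sum_filter_not S (fun i => x i ≤ t + 1)]
    have h1 := hB t (S.filter fun i => x i ≤ t + 1) (Finset.filter_subset _ _) (fun i hi => by
      rw [Finset.mem_filter] at hi
      exact ⟨(hS i hi.1).1, hi.2⟩)
    have h2 := ih (t + 1) (S.filter fun i => ¬ x i ≤ t + 1) (fun i hi => by
      rw [Finset.mem_filter] at hi
      have := (hS i hi.1).2
      push_cast at this
      exact ⟨(not_le.1 hi.2).le, by linarith⟩)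
      (fun τ T hT => hB τ T (hT.trans (Finset.filter_subset _ _)))
    push_cast
    linarith

/-- Among points of the dyadic range `Q ≤ q < 2 * Q` close to the curve, those having a close
neighbour are controlled by the points of small height close to the dual curve. -/
theorem card_le_add_sum_dual {Λ κ Q c : ℝ} {f g F G : ℝ → ℝ} (h : UnifConvex Λ f g)
    (hG : ∀ y, g (G y) = y) (hF : ∀ y, F y = y * G y - f (G y)) (hκ : κ = 1 / (256 * Λ ^ 3))
    (hQ : 1 ≤ Q) (hc : 0 < c) (hcΛ : c ≤ 1 / (16 * Λ)) (t : ℝ) (S : Finset (ℤ × ℤ × ℤ))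
    (hS : ∀ P ∈ S, IsPrim P ∧ IsNear κ f P ∧ Q ≤ P.1 ∧ (P.1 : ℝ) < 2 * Q ∧
      t ≤ (P.2.1 : ℝ) / P.1 ∧ (P.2.1 : ℝ) / P.1 ≤ t + 1) :
    ∃ D : Finset (ℤ × ℤ × ℤ), (∀ b ∈ D, IsPrim b ∧ IsNear κ F b ∧ (b.1 : ℝ) < 4 * c * Q ∧
      g t - 1 ≤ (b.2.1 : ℝ) / b.1 ∧ (b.2.1 : ℝ) / b.1 ≤ g (t + 1) + 1) ∧
      (S.card : ℝ) ≤ Q / c + 1 + 10 * Q * ∑ b ∈ D, 1 / (b.1 : ℝ) := by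
  classical
  have hΛ := h.one_le
  have hQ0 : 0 < Q := by linarith
  have hκ0 : 0 < κ := by rw [hκ]; positivity
  have hκ8 : κ ≤ 1 / 256 := by
    rw [hκ]
    apply one_div_le_one_div_of_le (by norm_num)
    nlinarith [one_le_pow₀ hΛ (n := 3)]
  have hc1 : 4 * c ≤ 1 := by
    have : 1 / (16 * Λ) ≤ 1 / 16 := by
      apply one_div_le_one_div_of_le (by norm_num); linarith
    linarith
  set X : ℤ × ℤ × ℤ → ℝ := fun P => (P.2.1 : ℝ) / P.1 with hX
  set close : ℤ × ℤ × ℤ → Prop := fun P => ∃ R ∈ S, R ≠ P ∧ |X P - X R| < c / Q with hclose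
  have hU : ((S.filter fun P => ¬ close P).card : ℝ) ≤ Q / c + 1 := by
    have := card_le_of_separated (S.filter fun P => ¬ close P) X (s := c / Q) (w := 1)
      (by positivity) (by norm_num) (fun P hP R hR hne => ?_) (fun P hP R hR => ?_)
    · rwa [one_div_div] at this
    · rw [Finset.mem_filter] at hP hR
      by_contra! hlt
      exact hP.2 ⟨R, hR.1, hne.symm, hlt⟩
    · obtain ⟨-, -, -, -, a1, a2⟩ := hS P (Finset.mem_filter.1 hP).1
      obtain ⟨-, -, -, -, b1, b2⟩ := hS R (Finset.mem_filter.1 hR).1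
      rw [abs_sub_le_iff]
      simp only [hX]
      constructor <;> linarith
  have hV : ∀ P ∈ S.filter close, ∃ b, IsPrim b ∧ IsNear κ F b ∧ Incident b P ∧
      (b.1 : ℝ) < 4 * c * Q ∧ g t - 1 ≤ (b.2.1 : ℝ) / b.1 ∧
      (b.2.1 : ℝ) / b.1 ≤ g (t + 1) + 1 := by
    intro P hP
    obtain ⟨hPS, R, hRS, hne, hlt⟩ := Finset.mem_filter.1 hP
    obtain ⟨hp, hPn, hPQ, hPQ', hPt, hPt'⟩ := hS P hPS
    obtain ⟨hr, hRn, hRQ, hRQ', hRt, hRt'⟩ := hS R hRS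
    have hne' : X R ≠ X P :=
      abscissa_ne hr hp hRn hPn hQ0 hκ0.le (by linarith) hRQ hRQ' hPQ hPQ' hne
    have hbound : ∀ u v : ℝ, |u - v| < c / Q → Q * (v - u) ≤ 1 / (16 * Λ) ∧
        4 * Q ^ 2 * (v - u) < 4 * c * Q := by
      intro u v huv
      rw [lt_div_iff₀ hQ0] at huv
      have : v - u ≤ |u - v| := by rw [abs_sub_comm]; exact le_abs_self _
      constructor <;> nlinarith
    rcases lt_or_gt_of_ne hne' with hx | hx
    · rw [abs_sub_comm] at hlt
      obtain ⟨b, b1, b2, b3, b4, b5, b6, b7⟩ := exists_dual_point h hG hF hκ hQ0 hRn hPn hRQ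
        hRQ' hPQ hPQ' hx (hbound _ _ hlt).1
      exact ⟨b, b1, b2, b4, b5.trans_lt (hbound _ _ hlt).2, by linarith [h.mono hRt],
        by linarith [h.mono hPt']⟩
    · obtain ⟨b, b1, b2, b3, b4, b5, b6, b7⟩ := exists_dual_point h hG hF hκ hQ0 hPn hRn hPQ
        hPQ' hRQ hRQ' hx (hbound _ _ hlt).1
      exact ⟨b, b1, b2, b3, b5.trans_lt (hbound _ _ hlt).2, by linarith [h.mono hPt],
        by linarith [h.mono hRt']⟩
  -- Each point with a close neighbour is assigned one line through it; the fibres of `L` are then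
  -- bounded by `card_on_line_le`.
  choose! L hL using hV
  refine ⟨(S.filter close).image L, fun b hb => ?_, ?_⟩
  · obtain ⟨P, hP, rfl⟩ := Finset.mem_image.1 hb
    obtain ⟨a1, a2, -, a3, a4, a5⟩ := hL P hP
    exact ⟨a1, a2, a3, a4, a5⟩
  · have hVc : ((S.filter close).card : ℝ) ≤
        ∑ b ∈ (S.filter close).image L, 10 * Q * (1 / (b.1 : ℝ)) := by
      rw [Finset.card_eq_sum_card_image L (S.filter close)]
      push_cast
      refine Finset.sum_le_sum fun b hb => ?_
      obtain ⟨P, hP, rfl⟩ := Finset.mem_image.1 hb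
      obtain ⟨a1, a2, -, a3, -, -⟩ := hL P hP
      rw [mul_one_div]
      refine card_on_line_le h hG hκ hQ0 a1 a2.1 (by nlinarith) _ fun R hR => ?_
      obtain ⟨hR1, hR2⟩ := Finset.mem_filter.1 hR
      obtain ⟨p1, p2, p3, p4, -, -⟩ := hS R (Finset.mem_filter.1 hR1).1
      refine ⟨p1, p2, p3, p4, ?_⟩
      rw [← hR2]
      exact (hL R hR1).2.2.1
    rw [← Finset.mul_sum] at hVc
    rw [← Finset.card_filter_add_card_filter_not (s := S) close]
    push_cast
    linarith

/-- Strong induction on `k` for all curves of the class at once. Heights below `2 ^ k` give `K * β ^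
k` by induction. The top dyadic range gives `1 / c + 1` plus ten times a dual sum over heights below
`2 ^ (k - h)`; each of these is at most `(β - 1) / 2 * K * β ^ k`, and the total is `K * β ^ (k +
1)`. -/
theorem exists_sum_prim_le {Λ β : ℝ} (hΛ : 1 ≤ Λ) (hβ : 1 < β) : ∃ K : ℝ, 0 < K ∧
    ∀ (k : ℕ) (f g : ℝ → ℝ), UnifConvex Λ f g → ∀ (t : ℝ) (S : Finset (ℤ × ℤ × ℤ)),
      (∀ P ∈ S, IsPrim P ∧ IsNear (1 / (256 * Λ ^ 3)) f P ∧ (P.1 : ℝ) < 2 ^ k ∧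
        t ≤ (P.2.1 : ℝ) / P.1 ∧ (P.2.1 : ℝ) / P.1 ≤ t + 1) →
      ∑ P ∈ S, 1 / (P.1 : ℝ) ≤ K * β ^ k := by
  classical
  -- The dual slopes run from `g t - 1` to `g (t + 1) + 1`, a length of at most `Λ + 2`, covered by
  -- `n + 1` unit intervals.
  set n : ℕ := ⌈Λ⌉₊ + 1 with hn
  have hnΛ : Λ + 2 ≤ n + 1 := by
    have := Nat.le_ceil Λ
    rw [hn]; push_cast; linarith
  -- `h₁` makes the gain `β ^ h` outweigh the loss `10 * (n + 1)` of one duality step; `h₂` makes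
  -- `c` small enough for that step.
  obtain ⟨h₁, hh₁⟩ := pow_unbounded_of_one_lt (10 * (n + 1) / ((β - 1) / 2)) hβ
  obtain ⟨h₂, hh₂⟩ := pow_unbounded_of_one_lt (4 * Λ) (one_lt_two (α := ℝ))
  set h := max h₁ h₂ with hh
  have hβ1 : 0 < β - 1 := by linarith
  have hβ0 : 0 < β := by linarith
  have e1 : 10 * (n + 1) ≤ (β - 1) / 2 * β ^ h := by
    rw [div_lt_iff₀ (by positivity)] at hh₁
    have : β ^ h₁ ≤ β ^ h := pow_le_pow_right₀ hβ.le (le_max_left _ _)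
    nlinarith
  have e2 : 4 * Λ ≤ 2 ^ h :=
    hh₂.le.trans (pow_le_pow_right₀ one_le_two (le_max_right _ _))
  set c : ℝ := 1 / (4 * 2 ^ h) with hc
  have hc0 : 0 < c := by positivity
  have hcΛ : c ≤ 1 / (16 * Λ) := by
    rw [hc]
    apply one_div_le_one_div_of_le (by linarith)
    linarith
  set K : ℝ := (1 / c + 1) / ((β - 1) / 2) with hK
  have hK0 : 0 < K := by positivity
  have hKe : 1 / c + 1 = K * ((β - 1) / 2) := by rw [hK]; field_simp
  refine ⟨K, hK0, fun k => ?_⟩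
  induction k using Nat.strong_induction_on with
  | _ k ih =>
  rcases k with _ | k
  · intro f g hfg t S hS
    have : S = ∅ := by
      refine Finset.eq_empty_of_forall_notMem fun P hP => ?_
      obtain ⟨-, h2, h3, -⟩ := hS P hP
      have : P.1 < 1 := by
        rw [pow_zero] at h3
        exact_mod_cast h3
      have := h2.1
      omega
    rw [this, Finset.sum_empty]
    positivity
  intro f g hfg t S hS
  obtain ⟨F, G, hFG, hG, hF⟩ := hfg.exists_dual
  set Q : ℝ := 2 ^ k with hQ
  have hQ1 : 1 ≤ Q := one_le_pow₀ one_le_two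
  have hQ0 : 0 < Q := by linarith
  obtain ⟨D, hD, hcard⟩ := card_le_add_sum_dual hfg hG hF rfl hQ1 hc0 hcΛ t
    (S.filter fun P => ¬ (P.1 : ℝ) < 2 ^ k) (fun P hP => by
      obtain ⟨hP1, hP2⟩ := Finset.mem_filter.1 hP
      obtain ⟨a1, a2, a3, a4, a5⟩ := hS P hP1
      rw [pow_succ'] at a3
      exact ⟨a1, a2, not_lt.1 hP2, a3, a4, a5⟩)
  have hlow := ih k (Nat.lt_succ_self k) f g hfg t (S.filter fun P => (P.1 : ℝ) < 2 ^ k)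
    (fun P hP => by
      obtain ⟨hP1, hP2⟩ := Finset.mem_filter.1 hP
      obtain ⟨a1, a2, a3, a4, a5⟩ := hS P hP1
      exact ⟨a1, a2, hP2, a4, a5⟩)
  have hDlt : ∀ b ∈ D, (b.1 : ℝ) * 2 ^ h < 2 ^ k := by
    intro b hb
    have := (hD b hb).2.2.1
    rw [hc] at this
    have e : 4 * (1 / (4 * 2 ^ h)) * Q = Q / 2 ^ h := by field_simp
    rwa [e, lt_div_iff₀ (by positivity)] at this
  -- Multiplying by `β ^ h` avoids the exponent `k - h` when `k < h`; in that case `D` is empty,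
  -- since heights are at least `1`.
  have hDsum : ∑ b ∈ D, 1 / (b.1 : ℝ) * β ^ h ≤ (n + 1) * (K * β ^ k) := by
    by_cases hkh : h ≤ k
    · rw [← Finset.sum_mul]
      have key := sum_le_of_unit_intervals (fun b : ℤ × ℤ × ℤ => (b.2.1 : ℝ) / b.1)
        (fun b => 1 / (b.1 : ℝ)) (K * β ^ (k - h)) n (g t - 1) D (fun b hb => ?_)
        (fun τ T hT hTτ => ?_)
      · calc _ ≤ (n + 1) * (K * β ^ (k - h)) * β ^ h := by gcongr
          _ = (n + 1) * (K * (β ^ (k - h) * β ^ h)) := by ring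
          _ = _ := by rw [← pow_add, Nat.sub_add_cancel hkh]
      · obtain ⟨-, -, -, a1, a2⟩ := hD b hb
        have := hfg.upper t (t + 1) (by linarith)
        exact ⟨a1, by linarith⟩
      · refine ih (k - h) (by omega) F G hFG τ T fun b hb => ?_
        obtain ⟨a1, a2, -, -, -⟩ := hD b (hT hb)
        refine ⟨a1, a2, ?_, hTτ b hb⟩
        have := hDlt b (hT hb)
        rw [← Nat.sub_add_cancel hkh, pow_add] at this
        exact lt_of_mul_lt_mul_right this (by positivity)
    · have : D = ∅ := by
        refine Finset.eq_empty_of_forall_notMem fun b hb => ?_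
        have h1 := hDlt b hb
        have h2 : (2 : ℝ) ^ k ≤ 2 ^ h := pow_le_pow_right₀ one_le_two (by omega)
        have h3 : (1 : ℝ) ≤ b.1 := by exact_mod_cast (hD b hb).2.1.1
        nlinarith [pow_pos (two_pos (α := ℝ)) h]
      rw [this, Finset.sum_empty]
      positivity
  rw [← Finset.sum_mul] at hDsum
  have hhigh : ∑ P ∈ S.filter (fun P => ¬ (P.1 : ℝ) < 2 ^ k), 1 / (P.1 : ℝ) ≤
      1 / c + 1 + 10 * ∑ b ∈ D, 1 / (b.1 : ℝ) := by
    calc _ ≤ ∑ P ∈ S.filter (fun P => ¬ (P.1 : ℝ) < 2 ^ k), 1 / Q := by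
          refine Finset.sum_le_sum fun P hP => ?_
          exact one_div_le_one_div_of_le hQ0 (not_lt.1 (Finset.mem_filter.1 hP).2)
      _ = ((S.filter fun P => ¬ (P.1 : ℝ) < 2 ^ k).card : ℝ) / Q := by
          rw [Finset.sum_const, nsmul_eq_mul, mul_one_div]
      _ ≤ (Q / c + 1 + 10 * Q * ∑ b ∈ D, 1 / (b.1 : ℝ)) / Q := by gcongr
      _ = 1 / c + 1 / Q + 10 * ∑ b ∈ D, 1 / (b.1 : ℝ) := by field_simp
      _ ≤ _ := by
          have : 1 / Q ≤ 1 := (div_le_one hQ0).2 hQ1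
          linarith
  have hdual : 10 * ∑ b ∈ D, 1 / (b.1 : ℝ) ≤ (β - 1) / 2 * (K * β ^ k) := by
    have hβh : 0 < β ^ h := by positivity
    refine le_of_mul_le_mul_right ?_ hβh
    calc (10 * ∑ b ∈ D, 1 / (b.1 : ℝ)) * β ^ h = 10 * ((∑ b ∈ D, 1 / (b.1 : ℝ)) * β ^ h) := by
          ring
      _ ≤ 10 * ((n + 1) * (K * β ^ k)) := by gcongr
      _ = 10 * (n + 1) * (K * β ^ k) := by ring
      _ ≤ ((β - 1) / 2 * β ^ h) * (K * β ^ k) := by gcongr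
      _ = _ := by ring
  have hβk : 1 ≤ β ^ k := one_le_pow₀ hβ.le
  rw [← Finset.sum_filter_add_sum_filter_not S (fun P => (P.1 : ℝ) < 2 ^ k), pow_succ]
  have hconst : 1 / c + 1 ≤ K * ((β - 1) / 2) * β ^ k := by
    rw [hKe]
    exact le_mul_of_one_le_right (by positivity) hβk
  calc _ ≤ K * β ^ k + (1 / c + 1 + 10 * ∑ b ∈ D, 1 / (b.1 : ℝ)) := add_le_add hlow hhigh
    _ ≤ K * β ^ k + (K * ((β - 1) / 2) * β ^ k + (β - 1) / 2 * (K * β ^ k)) := by gcongr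
    _ = _ := by ring

/-- The weighted count of all (not necessarily primitive) integer points close to the curve. -/
theorem exists_sum_near_le {Λ α : ℝ} (hΛ : 1 ≤ Λ) (hα : 0 < α) (n : ℕ) : ∃ K : ℝ, 0 < K ∧
    ∀ f g : ℝ → ℝ, UnifConvex Λ f g → ∀ t Y : ℝ, 1 ≤ Y → ∀ S : Finset (ℤ × ℤ × ℤ),
      (∀ P ∈ S, IsNear (1 / (256 * Λ ^ 3)) f P ∧ (P.1 : ℝ) ≤ Y ∧
        t ≤ (P.2.1 : ℝ) / P.1 ∧ (P.2.1 : ℝ) / P.1 ≤ t + (n + 1)) →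
      ∑ P ∈ S, 1 / (P.1 : ℝ) ≤ K * Y ^ α := by
  classical
  set κ : ℝ := 1 / (256 * Λ ^ 3) with hκ
  -- Half of the exponent pays for the primitive points, the other half for the harmonic sum over
  -- the contents `m`.
  set β : ℝ := 2 ^ (α / 2) with hβ
  have hβ1 : 1 < β := Real.one_lt_rpow one_lt_two (by positivity)
  obtain ⟨K, hK, hmain⟩ := exists_sum_prim_le hΛ hβ1
  refine ⟨(1 + 2 / α) * ((n + 1) * (K * β)), by positivity, ?_⟩
  intro f g hfg t Y hY S hS
  have hY0 : 0 < Y := by linarith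
  have hdec : ∀ P ∈ S, ∃ m : ℤ, 0 < m ∧ ∃ a, IsPrim a ∧
      P.1 = m * a.1 ∧ P.2.1 = m * a.2.1 ∧ P.2.2 = m * a.2.2 := by
    intro P hP
    refine exists_isPrim P ?_
    rintro rfl
    exact lt_irrefl _ (hS 0 hP).1.1
  choose! m hm a ha hP1 hP2 hP3 using hdec
  have ha1 : ∀ P ∈ S, 0 < (a P).1 := by
    intro P hP
    have h1 := (hS P hP).1.1
    rw [hP1 P hP] at h1
    exact pos_of_mul_pos_right h1 (hm P hP).le
  have hm1 : ∀ P ∈ S, (1 : ℝ) ≤ m P := fun P hP => by exact_mod_cast hm P hP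
  have ha1' : ∀ P ∈ S, (1 : ℝ) ≤ (a P).1 := fun P hP => by exact_mod_cast ha1 P hP
  have hprod : ∀ P ∈ S, (P.1 : ℝ) = m P * (a P).1 := fun P hP => by exact_mod_cast hP1 P hP
  have hxa : ∀ P ∈ S, (P.2.1 : ℝ) / P.1 = ((a P).2.1 : ℝ) / (a P).1 := by
    intro P hP
    have h2 : (P.2.1 : ℝ) = m P * (a P).2.1 := by exact_mod_cast hP2 P hP
    rw [hprod P hP, h2]
    exact mul_div_mul_left _ _ (by linarith [hm1 P hP])
  -- The quantity in `IsNear` is homogeneous of degree two, so dividing by the content only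
  -- decreases it.
  have hnear : ∀ P ∈ S, IsNear κ f (a P) := by
    intro P hP
    refine ⟨ha1 P hP, le_trans ?_ (hS P hP).1.2⟩
    have h3 : (P.2.2 : ℝ) = m P * (a P).2.2 := by exact_mod_cast hP3 P hP
    rw [hxa P hP, h3, hprod P hP]
    have hm0 : (0 : ℝ) ≤ m P := by linarith [hm1 P hP]
    rw [mul_assoc (m P : ℝ) ((a P).1 : ℝ) (f _), ← mul_sub, abs_mul, abs_of_nonneg hm0]
    have hA := mul_nonneg (by linarith [ha1' P hP] : (0 : ℝ) ≤ (a P).1)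
      (abs_nonneg (((a P).1 : ℝ) * f (((a P).2.1 : ℝ) / (a P).1) - (a P).2.2))
    have hmm : (1 : ℝ) ≤ m P * m P := by nlinarith [hm1 P hP]
    nlinarith
  set k : ℕ := Nat.log 2 ⌊Y⌋₊ with hk
  have hfl : ⌊Y⌋₊ ≠ 0 := (Nat.floor_pos.2 hY).ne'
  have hYk : Y < 2 ^ (k + 1) := by
    have h1 : ⌊Y⌋₊ < 2 ^ (k + 1) := Nat.lt_pow_succ_log_self one_lt_two _
    exact_mod_cast (Nat.floor_lt hY0.le).1 h1
  have hkY : (2 : ℝ) ^ k ≤ Y := by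
    have h1 : 2 ^ k ≤ ⌊Y⌋₊ := Nat.pow_log_le_self 2 hfl
    calc (2 : ℝ) ^ k ≤ (⌊Y⌋₊ : ℝ) := by exact_mod_cast h1
      _ ≤ Y := Nat.floor_le hY0.le
  have hβk : β ^ (k + 1) ≤ β * Y ^ (α / 2) := by
    rw [pow_succ']
    gcongr
    calc β ^ k = ((2 : ℝ) ^ k) ^ (α / 2) := by
          rw [hβ, ← Real.rpow_natCast, ← Real.rpow_mul two_pos.le, mul_comm,
            Real.rpow_mul two_pos.le, Real.rpow_natCast]
      _ ≤ _ := by gcongr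
  have hinner : ∀ j ∈ Finset.Icc 1 ⌊Y⌋₊, ∑ P ∈ S with (m P).toNat = j, 1 / (P.1 : ℝ) ≤
      (j : ℝ)⁻¹ * ((n + 1) * (K * β ^ (k + 1))) := by
    intro j hj
    have hmj : ∀ P ∈ S.filter (fun P => (m P).toNat = j), m P = j := by
      intro P hP
      obtain ⟨h1, h2⟩ := Finset.mem_filter.1 hP
      rw [← h2, Int.toNat_of_nonneg (hm P h1).le]
    have hinj : InjOn a (S.filter (fun P => (m P).toNat = j) : Finset (ℤ × ℤ × ℤ)) := by
      intro P hP R hR hPR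
      have h1 := (Finset.mem_filter.1 hP).1
      have h2 := (Finset.mem_filter.1 hR).1
      have h3 := hmj P hP
      have h4 := hmj R hR
      ext
      · rw [hP1 P h1, hP1 R h2, h3, h4, hPR]
      · rw [hP2 P h1, hP2 R h2, h3, h4, hPR]
      · rw [hP3 P h1, hP3 R h2, h3, h4, hPR]
    have heq : ∑ P ∈ S with (m P).toNat = j, 1 / (P.1 : ℝ) =
        (j : ℝ)⁻¹ * ∑ b ∈ (S.filter (fun P => (m P).toNat = j)).image a, 1 / (b.1 : ℝ) := by
      rw [Finset.sum_image hinj, Finset.mul_sum]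
      refine Finset.sum_congr rfl fun P hP => ?_
      rw [hprod P (Finset.mem_filter.1 hP).1, hmj P hP]
      push_cast
      rw [one_div, mul_inv, one_div]
    rw [heq]
    gcongr
    refine sum_le_of_unit_intervals (fun b : ℤ × ℤ × ℤ => (b.2.1 : ℝ) / b.1) _ _ n t _
      (fun b hb => ?_) (fun τ T hT hTτ => hmain (k + 1) f g hfg τ T fun b hb => ?_)
    · obtain ⟨P, hP, rfl⟩ := Finset.mem_image.1 hb
      have hPS := (Finset.mem_filter.1 hP).1
      rw [← hxa P hPS]
      exact (hS P hPS).2.2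
    · obtain ⟨P, hP, rfl⟩ := Finset.mem_image.1 (hT hb)
      have hPS := (Finset.mem_filter.1 hP).1
      refine ⟨ha P hPS, hnear P hPS, lt_of_le_of_lt ?_ hYk, hTτ _ hb⟩
      refine le_trans ?_ (hS P hPS).2.1
      rw [hprod P hPS]
      nlinarith [hm1 P hPS, ha1' P hPS]
  have hmaps : ∀ P ∈ S, (m P).toNat ∈ Finset.Icc 1 ⌊Y⌋₊ := by
    intro P hP
    have h0 := hm P hP
    rw [Finset.mem_Icc]
    refine ⟨by omega, Nat.le_floor ?_⟩
    have h1 : (((m P).toNat : ℤ) : ℝ) = m P := by rw [Int.toNat_of_nonneg h0.le]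
    rw [Int.cast_natCast] at h1
    rw [h1]
    refine le_trans ?_ (hS P hP).2.1
    rw [hprod P hP]
    nlinarith [hm1 P hP, ha1' P hP]
  rw [← Finset.sum_fiberwise_of_maps_to hmaps]
  have hharm : ∑ j ∈ Finset.Icc 1 ⌊Y⌋₊, (j : ℝ)⁻¹ ≤ (1 + 2 / α) * Y ^ (α / 2) := by
    have h1 := harmonic_floor_le_one_add_log Y hY
    rw [harmonic_eq_sum_Icc] at h1
    push_cast at h1
    have h2 := Real.log_le_rpow_div hY0.le (half_pos hα)
    have h3 : 1 ≤ Y ^ (α / 2) := Real.one_le_rpow hY (by positivity)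
    have h4 : Y ^ (α / 2) / (α / 2) = 2 / α * Y ^ (α / 2) := by field_simp
    linarith
  calc _ ≤ ∑ j ∈ Finset.Icc 1 ⌊Y⌋₊, (j : ℝ)⁻¹ * ((n + 1) * (K * β ^ (k + 1))) :=
        Finset.sum_le_sum hinner
    _ = (∑ j ∈ Finset.Icc 1 ⌊Y⌋₊, (j : ℝ)⁻¹) * ((n + 1) * (K * β ^ (k + 1))) := by
        rw [Finset.sum_mul]
    _ ≤ ((1 + 2 / α) * Y ^ (α / 2)) * ((n + 1) * (K * (β * Y ^ (α / 2)))) := by gcongr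
    _ = (1 + 2 / α) * ((n + 1) * (K * β)) * (Y ^ (α / 2) * Y ^ (α / 2)) := by ring
    _ = _ := by rw [← Real.rpow_add hY0, add_halves]

/-! ### Transference between a parallelepiped and its dual. -/

theorem le_card_Icc_of_one_le (t : ℝ) {w : ℝ} (hw : 1 ≤ w) :
    w ≤ ((Finset.Icc ⌈t - w⌉ ⌊t + w⌋).card : ℝ) := by
  rw [Int.card_Icc]
  have h1 := Int.ceil_lt_add_one (t - w)
  have h2 := Int.lt_floor_add_one (t + w)
  have h3 : ((⌊t + w⌋ + 1 - ⌈t - w⌉ : ℤ) : ℝ) ≤ ((⌊t + w⌋ + 1 - ⌈t - w⌉).toNat : ℤ) := by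
    exact_mod_cast Int.self_le_toNat _
  rw [Int.cast_natCast] at h3
  push_cast at h3
  linarith

/-- Integer points of a parallelepiped given by a unitriangular system of linear forms. -/
theorem exists_triangular_box (x y s : ℝ) {w₁ w₂ w₃ : ℝ} (h₁ : 1 ≤ w₁) (h₂ : 1 ≤ w₂)
    (h₃ : 1 ≤ w₃) : ∃ U : Finset (ℤ × ℤ × ℤ),
    (∀ u ∈ U, |(u.2.2 : ℝ)| ≤ w₃ ∧ |(u.2.1 : ℝ) + s * u.2.2| ≤ w₂ ∧
      |(u.1 : ℝ) + x * u.2.1 + y * u.2.2| ≤ w₁) ∧ w₁ * w₂ * w₃ ≤ (U.card : ℝ) := by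
  classical
  let I : ℝ → ℝ → Finset ℤ := fun t w => Finset.Icc ⌈t - w⌉ ⌊t + w⌋
  have hI : ∀ t w (z : ℤ), z ∈ I t w → |(z : ℝ) - t| ≤ w := by
    intro t w z hz
    obtain ⟨h1, h2⟩ := Finset.mem_Icc.1 hz
    rw [Int.ceil_le] at h1
    rw [Int.le_floor] at h2
    rw [abs_le]; constructor <;> linarith
  -- By triangularity the coordinates can be chosen from last to first, each in an interval whose
  -- centre depends on the earlier choices.
  let V : Finset (Σ _ : ℤ, Σ _ : ℤ, ℤ) := (I 0 w₃).sigma fun c =>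
    (I (-(s * c)) w₂).sigma fun b => I (-(x * b + y * c)) w₁
  refine ⟨V.image fun v => (v.2.2, v.2.1, v.1), fun u hu => ?_, ?_⟩
  · obtain ⟨⟨c, b, d⟩, hv, rfl⟩ := Finset.mem_image.1 hu
    simp only [V, Finset.mem_sigma] at hv
    obtain ⟨v1, v2, v3⟩ := hv
    refine ⟨by simpa using hI _ _ _ v1, ?_, ?_⟩
    · have := hI _ _ _ v2
      rwa [sub_neg_eq_add] at this
    · have := hI _ _ _ v3
      rw [sub_neg_eq_add, ← add_assoc] at this
      exact this
  · rw [Finset.card_image_of_injective]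
    · simp only [V, Finset.card_sigma]
      push_cast
      have hin : ∀ c : ℤ, w₁ * w₂ ≤ ∑ b ∈ I (-(s * c)) w₂, ((I (-(x * b + y * c)) w₁).card : ℝ) := by
        intro c
        calc w₁ * w₂ = w₂ * w₁ := mul_comm _ _
          _ ≤ ((I (-(s * c)) w₂).card : ℝ) * w₁ := by
              gcongr; exact le_card_Icc_of_one_le _ h₂
          _ = ∑ b ∈ I (-(s * c)) w₂, w₁ := by rw [Finset.sum_const, nsmul_eq_mul]
          _ ≤ _ := Finset.sum_le_sum fun b _ => le_card_Icc_of_one_le _ h₁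
      calc w₁ * w₂ * w₃ = w₃ * (w₁ * w₂) := mul_comm _ _
        _ ≤ ((I 0 w₃).card : ℝ) * (w₁ * w₂) := by
            gcongr; exact le_card_Icc_of_one_le _ h₃
        _ = ∑ c ∈ I 0 w₃, w₁ * w₂ := by rw [Finset.sum_const, nsmul_eq_mul]
        _ ≤ _ := Finset.sum_le_sum fun c _ => hin c
    · rintro ⟨a, b, c⟩ ⟨a', b', c'⟩ h
      simp only [Prod.mk.injEq] at h
      obtain ⟨rfl, rfl, rfl⟩ := h
      rfl

section Parseval

variable {N : ℕ} [NeZero N]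

/-- The reduction modulo `N` of an integer vector. -/
def reduceMod (N : ℕ) (P : ℤ × ℤ × ℤ) : ZMod N × ZMod N × ZMod N := (P.1, P.2.1, P.2.2)

/-- The exponential sum over a set of integer vectors, as a function on `(ℤ / N) ^ 3`. -/
noncomputable def expSum (S : Finset (ℤ × ℤ × ℤ)) (v : ZMod N × ZMod N × ZMod N) : ℂ :=
  ∑ P ∈ S, ZMod.stdAddChar (v.1 * (P.1 : ZMod N) + v.2.1 * (P.2.1 : ZMod N) +
    v.2.2 * (P.2.2 : ZMod N))

theorem sum_stdAddChar_mul (b : ZMod N) :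
    ∑ x : ZMod N, (ZMod.stdAddChar (x * b) : ℂ) = if b = 0 then (N : ℂ) else 0 := by
  have := AddChar.sum_mulShift b (ZMod.isPrimitive_stdAddChar N)
  rw [this, ZMod.card]
  split_ifs <;> simp

theorem sum_stdAddChar_triple (b : ZMod N × ZMod N × ZMod N) :
    ∑ v : ZMod N × ZMod N × ZMod N,
      (ZMod.stdAddChar (v.1 * b.1 + v.2.1 * b.2.1 + v.2.2 * b.2.2) : ℂ) =
      if b = 0 then (N : ℂ) ^ 3 else 0 := by
  simp only [AddChar.map_add_eq_mul, Fintype.sum_prod_type, ← Finset.mul_sum, ← Finset.sum_mul,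
    sum_stdAddChar_mul]
  obtain ⟨b1, b2, b3⟩ := b
  simp only [Prod.mk_eq_zero]
  by_cases h1 : b1 = 0 <;> by_cases h2 : b2 = 0 <;> by_cases h3 : b3 = 0 <;> simp [h1, h2, h3]
  ring

/-- Parseval: by orthogonality only pairs congruent modulo `N` survive, and injectivity leaves the
diagonal. -/
theorem sum_normSq_expSum (S : Finset (ℤ × ℤ × ℤ)) (hS : InjOn (reduceMod N) S) :
    ∑ v : ZMod N × ZMod N × ZMod N, ‖expSum S v‖ ^ 2 = (N : ℝ) ^ 3 * S.card := by
  classical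
  have h : ∀ v : ZMod N × ZMod N × ZMod N, ((‖expSum S v‖ ^ 2 : ℝ) : ℂ) =
      ∑ P ∈ S, ∑ R ∈ S, ZMod.stdAddChar (v.1 * (reduceMod N P - reduceMod N R).1 +
        v.2.1 * (reduceMod N P - reduceMod N R).2.1 +
        v.2.2 * (reduceMod N P - reduceMod N R).2.2) := by
    intro v
    rw [← Complex.normSq_eq_norm_sq, Complex.normSq_eq_conj_mul_self, mul_comm, expSum, map_sum,
      Finset.sum_mul_sum]
    refine Finset.sum_congr rfl fun P _ => Finset.sum_congr rfl fun R _ => ?_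
    rw [← AddChar.map_neg_eq_conj, ← AddChar.map_add_eq_mul]
    congr 1
    simp only [reduceMod, Prod.fst_sub, Prod.snd_sub]
    ring
  have hC : ((∑ v : ZMod N × ZMod N × ZMod N, ‖expSum S v‖ ^ 2 : ℝ) : ℂ) =
      ((N : ℝ) ^ 3 * S.card : ℝ) := by
    push_cast
    have h' := h
    push_cast at h'
    simp only [h']
    rw [Finset.sum_comm]
    have : ∀ P ∈ S, ∑ v : ZMod N × ZMod N × ZMod N, ∑ R ∈ S,
        (ZMod.stdAddChar (v.1 * (reduceMod N P - reduceMod N R).1 +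
        v.2.1 * (reduceMod N P - reduceMod N R).2.1 +
        v.2.2 * (reduceMod N P - reduceMod N R).2.2) : ℂ) = (N : ℂ) ^ 3 := by
      intro P hP
      rw [Finset.sum_comm]
      simp only [sum_stdAddChar_triple, sub_eq_zero]
      rw [Finset.sum_eq_single P]
      · simp
      · intro R hR hne
        rw [if_neg]
        intro he
        exact hne (hS hR hP he.symm)
      · exact fun h => absurd hP h
    rw [Finset.sum_congr rfl this, Finset.sum_const, nsmul_eq_mul, mul_comm]
  exact_mod_cast hC

end Parseval

/-- All phases lie within a sixth of a turn of a common one, so after rotation each term has real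
part at least `cos (π / 3) = 1 / 2`. -/
theorem half_card_le_norm_sum_exp {ι : Type*} (S : Finset ι) (θ : ι → ℝ) (θ₀ : ℝ)
    (h : ∀ i ∈ S, |θ i - θ₀| ≤ 1 / 6) :
    (S.card : ℝ) / 2 ≤ ‖∑ i ∈ S, Complex.exp (2 * Real.pi * Complex.I * θ i)‖ := by
  have h1 : ∑ i ∈ S, Complex.exp (2 * Real.pi * Complex.I * θ i) =
      Complex.exp ((2 * Real.pi * θ₀ : ℝ) * Complex.I) *
        ∑ i ∈ S, Complex.exp ((2 * Real.pi * (θ i - θ₀) : ℝ) * Complex.I) := by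
    rw [Finset.mul_sum]
    refine Finset.sum_congr rfl fun i _ => ?_
    rw [← Complex.exp_add]
    congr 1
    push_cast
    ring
  rw [h1, norm_mul, Complex.norm_exp_ofReal_mul_I, one_mul]
  refine le_trans ?_ (Complex.re_le_norm _)
  rw [Complex.re_sum]
  simp only [Complex.exp_ofReal_mul_I_re]
  have h2 : ∀ i ∈ S, (1 : ℝ) / 2 ≤ Real.cos (2 * Real.pi * (θ i - θ₀)) := by
    intro i hi
    rw [← Real.cos_abs, ← Real.cos_pi_div_three, abs_mul, abs_of_pos Real.two_pi_pos]
    have hpi := Real.pi_pos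
    have := h i hi
    apply Real.cos_le_cos_of_nonneg_of_le_pi (by positivity) (by linarith)
    nlinarith
  calc (S.card : ℝ) / 2 = ∑ i ∈ S, (1 : ℝ) / 2 := by
        rw [Finset.sum_const, nsmul_eq_mul, mul_one_div]
    _ ≤ _ := Finset.sum_le_sum h2

theorem exists_injOn_reduceMod (S : Finset (ℤ × ℤ × ℤ)) :
    ∃ N₀ : ℕ, ∀ N, N₀ ≤ N → InjOn (reduceMod N) S := by
  set M : ℕ := ∑ P ∈ S, (P.1.natAbs + P.2.1.natAbs + P.2.2.natAbs) with hM
  have hb : ∀ P ∈ S, P.1.natAbs + P.2.1.natAbs + P.2.2.natAbs ≤ M := fun P hP =>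
    Finset.single_le_sum (f := fun P : ℤ × ℤ × ℤ => P.1.natAbs + P.2.1.natAbs + P.2.2.natAbs)
      (fun _ _ => Nat.zero_le _) hP
  refine ⟨2 * M + 1, fun N hN P hP R hR hPR => ?_⟩
  have h1 := hb P hP
  have h2 := hb R hR
  have key : ∀ a b : ℤ, a.natAbs ≤ M → b.natAbs ≤ M → (a : ZMod N) = b → a = b := by
    intro a b ha hb hab
    have hd : (N : ℤ) ∣ a - b := (ZMod.intCast_eq_intCast_iff_dvd_sub b a N).1 hab.symm
    have : a - b = 0 := by
      apply Int.eq_zero_of_abs_lt_dvd hd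
      rw [abs_lt]
      omega
    omega
  simp only [reduceMod, Prod.mk.injEq] at hPR
  ext
  · exact key _ _ (by omega) (by omega) hPR.1
  · exact key _ _ (by omega) (by omega) hPR.2.1
  · exact key _ _ (by omega) (by omega) hPR.2.2

/-- Transference: the number of integer points in a translate of a parallelepiped is at most a
constant times its volume times the number of integer points in the dual parallelepiped. -/
theorem card_le_mul_card_dual (x y s : ℝ) {B₁ B₂ B₃ c : ℝ} (h₁ : 0 < B₁) (h₂ : 0 < B₂)
    (h₃ : 0 < B₃) (hc : 0 < c) (hc' : c ≤ 1 / 18) (S D : Finset (ℤ × ℤ × ℤ))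
    (P₀ : ℤ × ℤ × ℤ)
    (hS : ∀ P ∈ S, |((P.1 - P₀.1 : ℤ) : ℝ)| ≤ B₁ ∧
      |((P.2.1 - P₀.2.1 : ℤ) : ℝ) - ((P.1 - P₀.1 : ℤ) : ℝ) * x| ≤ B₂ ∧
      |((P.2.2 - P₀.2.2 : ℤ) : ℝ) - ((P.1 - P₀.1 : ℤ) : ℝ) * y -
        s * (((P.2.1 - P₀.2.1 : ℤ) : ℝ) - ((P.1 - P₀.1 : ℤ) : ℝ) * x)| ≤ B₃)
    (hD : ∀ a : ℤ × ℤ × ℤ, |(a.2.2 : ℝ)| ≤ 2 * c / B₃ → |(a.2.1 : ℝ) + s * a.2.2| ≤ 2 * c / B₂ →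
      |(a.1 : ℝ) + x * a.2.1 + y * a.2.2| ≤ 2 * c / B₁ → a ∈ D) :
    (S.card : ℝ) ≤ 4 / c ^ 3 * (B₁ * B₂ * B₃) * D.card := by
  classical
  -- The modulus is auxiliary: it must separate `S` and make every side of the frequency box at
  -- least `1`; its powers cancel at the end.
  obtain ⟨N₀, hN₀⟩ := exists_injOn_reduceMod S
  obtain ⟨N₁, hN₁⟩ := exists_nat_ge (B₁ / c + B₂ / c + B₃ / c)
  set N : ℕ := max (max N₀ N₁) 1 with hN
  have hN1 : 1 ≤ N := le_max_right _ _
  have : NeZero N := ⟨by omega⟩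
  have hNpos : (0 : ℝ) < N := by exact_mod_cast hN1
  have hinj : InjOn (reduceMod N) S := hN₀ N ((le_max_left _ _).trans (le_max_left _ _))
  have hNB : B₁ / c + B₂ / c + B₃ / c ≤ N := by
    refine hN₁.trans ?_
    exact_mod_cast (le_max_right _ _).trans (le_max_left (max N₀ N₁) 1)
  have p1 : 0 < B₁ / c := by positivity
  have p2 : 0 < B₂ / c := by positivity
  have p3 : 0 < B₃ / c := by positivity
  have hw : ∀ B : ℝ, 0 < B → B / c ≤ N → 1 ≤ N * c / B := by
    intro B hB h
    rw [div_le_iff₀ hc] at h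
    rwa [one_le_div hB]
  obtain ⟨U, hU, hUc⟩ := exists_triangular_box x y s (hw B₁ h₁ (by linarith))
    (hw B₂ h₂ (by linarith)) (hw B₃ h₃ (by linarith))
  -- For a frequency in the box the phase varies over `S` by at most `3 * c ≤ 1 / 6` from its value
  -- at `P₀`, so there is no cancellation.
  have hlow : ∀ u ∈ U, (S.card : ℝ) / 2 ≤ ‖expSum S (reduceMod N u)‖ := by
    intro u hu
    obtain ⟨u3, u2, u1⟩ := hU u hu
    have he : expSum S (reduceMod N u) = ∑ P ∈ S, Complex.exp (2 * Real.pi * Complex.I *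
        (((u.1 * P.1 + u.2.1 * P.2.1 + u.2.2 * P.2.2 : ℤ) / N : ℝ) : ℂ)) := by
      refine Finset.sum_congr rfl fun P _ => ?_
      have h := ZMod.stdAddChar_coe (N := N) (u.1 * P.1 + u.2.1 * P.2.1 + u.2.2 * P.2.2)
      simp only [reduceMod]
      push_cast at h ⊢
      rw [h, mul_div_assoc]
    rw [he]
    refine half_card_le_norm_sum_exp S
      (fun P => (u.1 * P.1 + u.2.1 * P.2.1 + u.2.2 * P.2.2 : ℤ) / N)
      ((u.1 * P₀.1 + u.2.1 * P₀.2.1 + u.2.2 * P₀.2.2 : ℤ) / N) fun P hP => ?_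
    obtain ⟨s1, s2, s3⟩ := hS P hP
    rw [← sub_div, abs_div, abs_of_pos hNpos, div_le_iff₀ hNpos]
    have hform : ((u.1 * P.1 + u.2.1 * P.2.1 + u.2.2 * P.2.2 : ℤ) : ℝ) -
        (u.1 * P₀.1 + u.2.1 * P₀.2.1 + u.2.2 * P₀.2.2 : ℤ) =
        ((P.1 - P₀.1 : ℤ) : ℝ) * ((u.1 : ℝ) + x * u.2.1 + y * u.2.2) +
        (((P.2.1 - P₀.2.1 : ℤ) : ℝ) - ((P.1 - P₀.1 : ℤ) : ℝ) * x) * ((u.2.1 : ℝ) + s * u.2.2) +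
        (((P.2.2 - P₀.2.2 : ℤ) : ℝ) - ((P.1 - P₀.1 : ℤ) : ℝ) * y -
        s * (((P.2.1 - P₀.2.1 : ℤ) : ℝ) - ((P.1 - P₀.1 : ℤ) : ℝ) * x)) * u.2.2 := by
      push_cast; ring
    rw [hform]
    have hm : ∀ a b B : ℝ, 0 < B → |a| ≤ B → |b| ≤ N * c / B → |a * b| ≤ N * c := by
      intro a b B hB ha hb
      rw [abs_mul]
      calc |a| * |b| ≤ B * (N * c / B) := by gcongr
        _ = N * c := by field_simp
    have m1 := hm _ _ _ h₁ s1 u1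
    have m2 := hm _ _ _ h₂ s2 u2
    have m3 := hm _ _ _ h₃ s3 u3
    refine (abs_add_three _ _ _).trans ?_
    nlinarith
  -- Two frequencies with equal residues differ by `N` times an integer point of the dual box, so
  -- each residue occurs at most `D.card` times.
  have hfib : ∀ v ∈ U.image (reduceMod N), (U.filter fun u => reduceMod N u = v).card ≤ D.card := by
    intro v hv
    obtain ⟨u₀, hu₀, rfl⟩ := Finset.mem_image.1 hv
    have hdvd : ∀ u ∈ U.filter (fun u => reduceMod N u = reduceMod N u₀),
        ∃ a : ℤ × ℤ × ℤ, u.1 = u₀.1 + N * a.1 ∧ u.2.1 = u₀.2.1 + N * a.2.1 ∧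
          u.2.2 = u₀.2.2 + N * a.2.2 := by
      intro u hu
      have h := (Finset.mem_filter.1 hu).2
      simp only [reduceMod, Prod.mk.injEq] at h
      obtain ⟨a, ha⟩ := (ZMod.intCast_eq_intCast_iff_dvd_sub _ _ N).1 h.1.symm
      obtain ⟨b, hb⟩ := (ZMod.intCast_eq_intCast_iff_dvd_sub _ _ N).1 h.2.1.symm
      obtain ⟨d, hd⟩ := (ZMod.intCast_eq_intCast_iff_dvd_sub _ _ N).1 h.2.2.symm
      exact ⟨(a, b, d), by linarith, by linarith, by linarith⟩
    choose! A hA1 hA2 hA3 using hdvd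
    refine Finset.card_le_card_of_injOn A (fun u hu => ?_) (fun u hu u' hu' hAA => ?_)
    · have huU := (Finset.mem_filter.1 (Finset.mem_coe.1 hu)).1
      obtain ⟨u3, u2, u1⟩ := hU u huU
      obtain ⟨v3, v2, v1⟩ := hU u₀ hu₀
      have e1 : (u.1 : ℝ) = u₀.1 + N * (A u).1 := by exact_mod_cast hA1 u hu
      have e2 : (u.2.1 : ℝ) = u₀.2.1 + N * (A u).2.1 := by exact_mod_cast hA2 u hu
      have e3 : (u.2.2 : ℝ) = u₀.2.2 + N * (A u).2.2 := by exact_mod_cast hA3 u hu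
      have hsc : ∀ p q z B : ℝ, |p| ≤ N * c / B → |q| ≤ N * c / B → p - q = N * z →
          |z| ≤ 2 * c / B := by
        intro p q z B hp hq hpq
        have h1 : |N * z| ≤ N * c / B + N * c / B := by
          rw [← hpq]
          exact (abs_sub _ _).trans (add_le_add hp hq)
        rw [abs_mul, abs_of_pos hNpos] at h1
        refine le_of_mul_le_mul_left (h1.trans_eq ?_) hNpos
        ring
      refine hD _ (hsc _ _ _ _ u3 v3 (by rw [e3]; ring)) (hsc _ _ _ _ u2 v2 ?_)
        (hsc _ _ _ _ u1 v1 ?_)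
      · rw [e2, e3]; ring
      · rw [e1, e2, e3]; ring
    · ext
      · rw [hA1 u hu, hA1 u' hu', hAA]
      · rw [hA2 u hu, hA2 u' hu', hAA]
      · rw [hA3 u hu, hA3 u' hu', hAA]
  have hup : ∑ u ∈ U, ‖expSum S (reduceMod N u)‖ ^ 2 ≤ D.card * ((N : ℝ) ^ 3 * S.card) := by
    rw [← sum_normSq_expSum S hinj, Finset.sum_comp (fun v => ‖expSum S v‖ ^ 2) (reduceMod N)]
    calc _ ≤ ∑ v ∈ U.image (reduceMod N), (D.card : ℝ) * ‖expSum S v‖ ^ 2 := by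
          refine Finset.sum_le_sum fun v hv => ?_
          rw [nsmul_eq_mul]
          have := hfib v hv
          gcongr
      _ = (D.card : ℝ) * ∑ v ∈ U.image (reduceMod N), ‖expSum S v‖ ^ 2 := by
          rw [Finset.mul_sum]
      _ ≤ _ := by
          gcongr
          exact Finset.subset_univ _
  have hdown : N * c / B₁ * (N * c / B₂) * (N * c / B₃) * ((S.card : ℝ) / 2) ^ 2 ≤
      ∑ u ∈ U, ‖expSum S (reduceMod N u)‖ ^ 2 := by
    calc _ ≤ (U.card : ℝ) * ((S.card : ℝ) / 2) ^ 2 := by gcongr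
      _ = ∑ u ∈ U, ((S.card : ℝ) / 2) ^ 2 := by rw [Finset.sum_const, nsmul_eq_mul]
      _ ≤ _ := Finset.sum_le_sum fun u hu => by
          have := hlow u hu
          gcongr
  rcases Nat.eq_zero_or_pos S.card with h0 | h0
  · rw [h0]; push_cast; positivity
  have h0' : (0 : ℝ) < S.card := by exact_mod_cast h0
  have hfin := hdown.trans hup
  have hk : 0 < (N : ℝ) ^ 3 * S.card * (c ^ 3 / (4 * (B₁ * B₂ * B₃))) := by positivity
  refine le_of_mul_le_mul_left ?_ hk
  calc _ = N * c / B₁ * (N * c / B₂) * (N * c / B₃) * ((S.card : ℝ) / 2) ^ 2 := by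
        field_simp; norm_num
    _ ≤ _ := hfin
    _ = _ := by field_simp

/-! ### Cells, dual boxes and the count for a uniformly convex function. -/

theorem finite_of_abs_le (M : ℝ) :
    {b : ℤ × ℤ × ℤ | |(b.1 : ℝ)| ≤ M ∧ |(b.2.1 : ℝ)| ≤ M ∧ |(b.2.2 : ℝ)| ≤ M}.Finite := by
  have hfin : ((Icc (-⌊M⌋) ⌊M⌋) ×ˢ ((Icc (-⌊M⌋) ⌊M⌋) ×ˢ (Icc (-⌊M⌋) ⌊M⌋)) :
      Set (ℤ × ℤ × ℤ)).Finite :=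
    (finite_Icc _ _).prod ((finite_Icc _ _).prod (finite_Icc _ _))
  refine hfin.subset ?_
  have key : ∀ z : ℤ, |(z : ℝ)| ≤ M → z ∈ Icc (-⌊M⌋) ⌊M⌋ := by
    intro z hz
    have : |z| ≤ ⌊M⌋ := by
      rw [Int.le_floor]
      push_cast
      exact hz
    exact abs_le.1 this
  rintro ⟨u, v, w⟩ ⟨h1, h2, h3⟩
  exact ⟨key _ h1, key _ h2, key _ h3⟩

/-- The integer points of positive height in the parallelepiped dual to the box of size `X / Q` at
the abscissa `x`. -/
def dualBox (f g : ℝ → ℝ) (Λ c δ Q X x : ℝ) : Set (ℤ × ℤ × ℤ) :=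
  {b | 0 < b.1 ∧ (b.1 : ℝ) ≤ c / (2 * Λ * δ) ∧ |(b.2.1 : ℝ) - g x * b.1| ≤ c / (2 * X) ∧
    |(b.2.2 : ℝ) - x * b.2.1 + f x * b.1| ≤ 2 * c / Q}

theorem dualBox_finite (f g : ℝ → ℝ) (Λ c δ Q X x : ℝ) : (dualBox f g Λ c δ Q X x).Finite := by
  set M₁ := c / (2 * Λ * δ) with hM₁
  set M₂ := |g x| * M₁ + c / (2 * X) with hM₂
  set M₃ := |x| * M₂ + |f x| * M₁ + 2 * c / Q with hM₃
  refine (finite_of_abs_le (max M₁ (max M₂ M₃))).subset ?_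
  rintro b ⟨h0, h1, h2, h3⟩
  have h0' : (0 : ℝ) < b.1 := by exact_mod_cast h0
  have e1 : |(b.1 : ℝ)| ≤ M₁ := by rwa [abs_of_pos h0']
  have e2 : |(b.2.1 : ℝ)| ≤ M₂ := by
    calc |(b.2.1 : ℝ)| = |g x * b.1 + (b.2.1 - g x * b.1)| := by congr 1; ring
      _ ≤ |g x| * |(b.1 : ℝ)| + |(b.2.1 : ℝ) - g x * b.1| := by
          rw [← abs_mul]; exact abs_add_le _ _
      _ ≤ _ := by rw [hM₂]; gcongr
  have e3 : |(b.2.2 : ℝ)| ≤ M₃ := by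
    calc |(b.2.2 : ℝ)| = |x * b.2.1 + -(f x * b.1) + (b.2.2 - x * b.2.1 + f x * b.1)| := by
          congr 1; ring
      _ ≤ |x| * |(b.2.1 : ℝ)| + |f x| * |(b.1 : ℝ)| + |(b.2.2 : ℝ) - x * b.2.1 + f x * b.1| := by
          rw [← abs_mul, ← abs_mul, ← abs_neg (f x * b.1)]; exact abs_add_three _ _ _
      _ ≤ _ := by rw [hM₃]; gcongr
  exact ⟨e1.trans (le_max_left _ _), e2.trans ((le_max_left _ _).trans (le_max_right _ _)),
    e3.trans ((le_max_right _ _).trans (le_max_right _ _))⟩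

/-- Counting the points whose abscissa lies in a short interval by the dual points. -/
theorem card_cell_le {Λ c δ Q X x ℓ : ℝ} {f g : ℝ → ℝ} (h : UnifConvex Λ f g) (hc : 0 < c)
    (hc' : c ≤ 1 / 18) (hδ : 0 < δ) (hQ : 1 ≤ Q) (hX : 1 ≤ X) (hXℓ : X = Q * ℓ)
    (hδℓ : δ = X * ℓ) (θ : ℝ × ℝ) (S : Finset (ℤ × ℕ))
    (hS : ∀ z ∈ S, 0 < z.2 ∧ Q < (z.2 : ℝ) ∧ (z.2 : ℝ) ≤ 2 * Q ∧
      x ≤ ((z.1 : ℝ) + θ.1) / (z.2 : ℝ) ∧ ((z.1 : ℝ) + θ.1) / (z.2 : ℝ) ≤ x + ℓ ∧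
      distNearestInt ((z.2 : ℝ) * f (((z.1 : ℝ) + θ.1) / (z.2 : ℝ)) - θ.2) < δ) :
    (S.card : ℝ) ≤ 64 * Λ / c ^ 3 * (Q * X * δ) *
      (1 + 2 * ((dualBox_finite f g Λ c δ Q X x).toFinset.card : ℝ)) := by
  classical
  have hΛ := h.one_le
  have hΛ0 := h.pos
  have hX0 : 0 < X := by linarith
  have hQ0 : 0 < Q := by linarith
  set E := (dualBox_finite f g Λ c δ Q X x).toFinset with hE
  have hmemE : ∀ b, b ∈ E ↔ b ∈ dualBox f g Λ c δ Q X x := fun b => by rw [hE]; simp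
  set D : Finset (ℤ × ℤ × ℤ) := {0} ∪ (E.image (fun b => (b.2.2, -b.2.1, b.1)) ∪
    E.image (fun b => (-b.2.2, b.2.1, -b.1))) with hD
  have hDc : (D.card : ℝ) ≤ 1 + 2 * (E.card : ℝ) := by
    have h1 := Finset.card_union_le {(0 : ℤ × ℤ × ℤ)}
      (E.image (fun b => (b.2.2, -b.2.1, b.1)) ∪ E.image (fun b => (-b.2.2, b.2.1, -b.1)))
    have h2 := Finset.card_union_le (E.image (fun b => (b.2.2, -b.2.1, b.1)))
      (E.image (fun b => (-b.2.2, b.2.1, -b.1)))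
    have h3 := Finset.card_image_le (s := E) (f := fun b => (b.2.2, -b.2.1, b.1))
    have h4 := Finset.card_image_le (s := E) (f := fun b => (-b.2.2, b.2.1, -b.1))
    rw [Finset.card_singleton, ← hD] at h1
    have : D.card ≤ 1 + 2 * E.card := by omega
    exact_mod_cast this
  have hmemD : ∀ a : ℤ × ℤ × ℤ, |(a.2.2 : ℝ)| ≤ 2 * c / (4 * Λ * δ) →
      |(a.2.1 : ℝ) + g x * a.2.2| ≤ 2 * c / (4 * X) →
      |(a.1 : ℝ) + x * a.2.1 + f x * a.2.2| ≤ 2 * c / Q → a ∈ D := by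
    rintro ⟨a0, a1, a2⟩ h1 h2 h3
    simp only at h1 h2 h3
    have r1 : 2 * c / (4 * Λ * δ) = c / (2 * Λ * δ) := by
      rw [show 4 * Λ * δ = 2 * (2 * Λ * δ) by ring, mul_div_mul_left _ _ two_ne_zero]
    have r2 : 2 * c / (4 * X) = c / (2 * X) := by
      rw [show 4 * X = 2 * (2 * X) by ring, mul_div_mul_left _ _ two_ne_zero]
    rw [r1] at h1
    rw [r2] at h2
    rw [hD, Finset.mem_union, Finset.mem_union, Finset.mem_singleton, Finset.mem_image,
      Finset.mem_image]
    rcases lt_trichotomy a2 0 with hneg | rfl | hpos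
    · right; right
      refine ⟨(-a2, a1, -a0), (hmemE _).2 ⟨by simpa using hneg, ?_, ?_, ?_⟩, by simp⟩
      · push_cast; exact (neg_le_abs _).trans h1
      · push_cast
        rwa [mul_neg, sub_neg_eq_add]
      · push_cast
        rw [← abs_neg]
        convert h3 using 2
        ring
    -- At height zero the other two sides of the box are shorter than `1`, which leaves only the
    -- origin.
    · left
      have z1 : a1 = 0 := by
        have : c / (2 * X) < 1 := by
          rw [div_lt_one (by positivity)]; linarith
        simp only [Int.cast_zero, mul_zero, add_zero] at h2
        exact Int.abs_lt_one_iff.1 (by exact_mod_cast h2.trans_lt this)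
      subst z1
      have z0 : a0 = 0 := by
        have : 2 * c / Q < 1 := by
          rw [div_lt_one (by positivity)]; linarith
        simp only [Int.cast_zero, mul_zero, add_zero] at h3
        exact Int.abs_lt_one_iff.1 (by exact_mod_cast h3.trans_lt this)
      subst z0
      rfl
    · right; left
      refine ⟨(a2, -a1, a0), (hmemE _).2 ⟨hpos, ?_, ?_, ?_⟩, by simp⟩
      · exact (le_abs_self _).trans h1
      · push_cast
        rw [← abs_neg]
        convert h2 using 2
        ring
      · push_cast
        convert h3 using 2
        ring
  rcases S.eq_empty_or_nonempty with rfl | ⟨z₀, hz₀⟩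
  · rw [Finset.card_empty]; push_cast; positivity
  set lift : ℤ × ℕ → ℤ × ℤ × ℤ := fun z =>
    ((z.2 : ℤ), z.1, round ((z.2 : ℝ) * f (((z.1 : ℝ) + θ.1) / (z.2 : ℝ)) - θ.2)) with hlift
  have hinj : Function.Injective lift := by
    intro z w hzw
    simp only [hlift, Prod.mk.injEq] at hzw
    ext
    · exact hzw.2.1
    · exact_mod_cast hzw.1
  -- Differences with `lift z₀` cancel both shifts `θ`. The last side collects the tangent error `2
  -- * Λ * δ` and two rounding errors `δ`.
  have hmain := card_le_mul_card_dual x (f x) (g x) (B₁ := Q) (B₂ := 4 * X) (B₃ := 4 * Λ * δ)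
    hQ0 (by positivity) (by positivity) hc hc' (S.image lift) D (lift z₀) ?_ hmemD
  · rw [Finset.card_image_of_injective _ hinj] at hmain
    refine hmain.trans ?_
    calc 4 / c ^ 3 * (Q * (4 * X) * (4 * Λ * δ)) * (D.card : ℝ)
        = 64 * Λ / c ^ 3 * (Q * X * δ) * (D.card : ℝ) := by ring
      _ ≤ _ := by gcongr
  · intro P hP
    obtain ⟨z, hz, rfl⟩ := Finset.mem_image.1 hP
    have hdata : ∀ z ∈ S, ∃ (u t : ℝ), 0 ≤ u ∧ u ≤ ℓ ∧ 0 ≤ t ∧ t ≤ 2 * Λ * δ ∧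
        (z.1 : ℝ) + θ.1 = z.2 * (x + u) ∧
        (z.2 : ℝ) * f (((z.1 : ℝ) + θ.1) / (z.2 : ℝ)) = z.2 * f x + g x * (z.2 * u) + t := by
      intro z hz
      obtain ⟨q1, q2, q3, q4, q5, q6⟩ := hS z hz
      have hq : (0 : ℝ) < z.2 := by exact_mod_cast q1
      set v := ((z.1 : ℝ) + θ.1) / (z.2 : ℝ) with hv
      have s1 := h.subgrad x v
      have s2 := h.le_quadratic x v
      refine ⟨v - x, z.2 * (f v - (f x + g x * (v - x))), by linarith, by linarith,
        mul_nonneg hq.le (by linarith), ?_, ?_, by ring⟩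
      · have hsq : (v - x) ^ 2 ≤ ℓ ^ 2 := by
          apply pow_le_pow_left₀ <;> linarith
        calc (z.2 : ℝ) * (f v - (f x + g x * (v - x))) ≤ 2 * Q * (Λ * ℓ ^ 2) := by
              apply mul_le_mul q3 _ (by linarith) (by linarith)
              have := mul_le_mul_of_nonneg_left hsq hΛ0.le
              linarith
          _ = 2 * Λ * δ := by rw [hδℓ, hXℓ]; ring
      · rw [hv]; field_simp; ring
    obtain ⟨u, t, u0, u1, t0, t1, zu, zt⟩ := hdata z hz
    obtain ⟨u', t', u0', u1', t0', t1', zu', zt'⟩ := hdata z₀ hz₀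
    obtain ⟨-, q2, q3, -, -, q6⟩ := hS z hz
    obtain ⟨-, q2', q3', -, -, q6'⟩ := hS z₀ hz₀
    unfold distNearestInt at q6 q6'
    have d1 : (0 : ℝ) ≤ z.2 * u := mul_nonneg (by linarith) u0
    have d2 : (z.2 : ℝ) * u ≤ 2 * X := by
      calc (z.2 : ℝ) * u ≤ 2 * Q * ℓ := by gcongr
        _ = 2 * X := by rw [hXℓ]; ring
    have d1' : (0 : ℝ) ≤ z₀.2 * u' := mul_nonneg (by linarith) u0'
    have d2' : (z₀.2 : ℝ) * u' ≤ 2 * X := by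
      calc (z₀.2 : ℝ) * u' ≤ 2 * Q * ℓ := by gcongr
        _ = 2 * X := by rw [hXℓ]; ring
    simp only [hlift]
    set r := round ((z.2 : ℝ) * f (((z.1 : ℝ) + θ.1) / (z.2 : ℝ)) - θ.2) with hr
    set r' := round ((z₀.2 : ℝ) * f (((z₀.1 : ℝ) + θ.1) / (z₀.2 : ℝ)) - θ.2) with hr'
    rw [zt, abs_lt] at q6
    rw [zt', abs_lt] at q6'
    have eL2 : (((z.1 - z₀.1 : ℤ) : ℝ) - (((z.2 : ℤ) - (z₀.2 : ℤ) : ℤ) : ℝ) * x) =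
        z.2 * u - z₀.2 * u' := by
      push_cast; linarith
    refine ⟨?_, ?_, ?_⟩
    · push_cast
      rw [abs_le]; constructor <;> linarith
    · rw [eL2, abs_le]; constructor <;> linarith
    · rw [eL2]
      push_cast
      have : δ ≤ Λ * δ := by nlinarith
      rw [abs_le]
      obtain ⟨a1, a2⟩ := q6
      obtain ⟨a1', a2'⟩ := q6'
      constructor <;> linarith

/-- The slope of `b` is so close to `g x` that its tangency point is near `x`; the tangent error
there is quadratic and costs `Λ³c²/4`, while the third side of the box costs `c²/(ΛδQ)`. The value
of `c` brings the sum under the nearness constant. The distance to `G` limits the cells that see a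
given `b`. -/
theorem dualBox_isNear {Λ c δ Q X x : ℝ} {f g F G : ℝ → ℝ} (h : UnifConvex Λ f g)
    (hG : ∀ y, g (G y) = y) (hF : ∀ y, F y = y * G y - f (G y)) (hc : c = 1 / (32 * Λ ^ 3))
    (hδ : 0 < δ) (hQ : 0 < Q) (hX : 1 ≤ X) (hδQ : 1 ≤ δ * Q) {b : ℤ × ℤ × ℤ}
    (hb : b ∈ dualBox f g Λ c δ Q X x) :
    IsNear (1 / (256 * Λ ^ 3)) F b ∧ |(b.2.1 : ℝ) / b.1 - g x| ≤ 1 ∧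
      |x - G ((b.2.1 : ℝ) / b.1)| ≤ Λ * c / (2 * X * b.1) := by
  obtain ⟨h0, h1, h2, h3⟩ := hb
  have hΛ := h.one_le
  have hΛ0 := h.pos
  have hΛ3 : 1 ≤ Λ ^ 3 := one_le_pow₀ hΛ
  have hc0 : 0 < c := by rw [hc]; positivity
  have hc1 : c ≤ 1 / 32 := by
    rw [hc]
    apply one_div_le_one_div_of_le (by norm_num)
    nlinarith
  have hX0 : 0 < X := by linarith
  have hb0 : (0 : ℝ) < b.1 := by exact_mod_cast h0
  have hb1 : (1 : ℝ) ≤ b.1 := by exact_mod_cast h0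
  set σ := (b.2.1 : ℝ) / b.1 with hσ
  have hσb : (b.2.1 : ℝ) = σ * b.1 := by rw [hσ]; field_simp
  have e1 : |σ - g x| ≤ c / (2 * X * b.1) := by
    rw [hσb, ← sub_mul, abs_mul, abs_of_pos hb0] at h2
    rw [← div_div, le_div_iff₀ hb0]
    exact h2
  have e2 : |x - G σ| ≤ Λ * c / (2 * X * b.1) := by
    have := h.abs_sub_le_slope (G σ) x
    rw [hG, abs_sub_comm] at this
    calc |x - G σ| ≤ Λ * |σ - g x| := this
      _ ≤ Λ * (c / (2 * X * b.1)) := by gcongr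
      _ = _ := by ring
  refine ⟨⟨h0, ?_⟩, ?_, e2⟩
  · have t1 := h.subgrad (G σ) x
    have t2 := h.le_quadratic (G σ) x
    rw [hG] at t1 t2
    have e3 : (x - G σ) ^ 2 ≤ (Λ * c / (2 * X * b.1)) ^ 2 := by
      rw [← sq_abs]; gcongr
    have e4 : |F σ - (σ * x - f x)| ≤ Λ * (Λ * c / (2 * X * b.1)) ^ 2 := by
      have := mul_le_mul_of_nonneg_left e3 hΛ0.le
      have : 0 ≤ Λ * (Λ * c / (2 * X * b.1)) ^ 2 := by positivity
      rw [hF, abs_le]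
      constructor <;> linarith
    have e5 : |(b.1 : ℝ) * F σ - b.2.2| ≤ b.1 * (Λ * (Λ * c / (2 * X * b.1)) ^ 2) + 2 * c / Q := by
      have : (b.1 : ℝ) * F σ - b.2.2 = b.1 * (F σ - (σ * x - f x)) -
          (b.2.2 - x * b.2.1 + f x * b.1) := by rw [hσb]; ring
      rw [this]
      refine (abs_sub _ _).trans (add_le_add ?_ h3)
      rw [abs_mul, abs_of_pos hb0]
      gcongr
    calc (b.1 : ℝ) * |(b.1 : ℝ) * F σ - b.2.2|
        ≤ b.1 * (b.1 * (Λ * (Λ * c / (2 * X * b.1)) ^ 2) + 2 * c / Q) := by gcongr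
      _ = Λ ^ 3 * c ^ 2 / (4 * X ^ 2) + b.1 * (2 * c / Q) := by field_simp; ring
      _ ≤ Λ ^ 3 * c ^ 2 / 4 + c / (2 * Λ * δ) * (2 * c / Q) := by
          gcongr
          nlinarith
      _ = Λ ^ 3 * c ^ 2 / 4 + c ^ 2 / (Λ * (δ * Q)) := by field_simp
      _ ≤ Λ ^ 3 * c ^ 2 / 4 + c ^ 2 / 1 := by
          gcongr
          nlinarith
      _ ≤ Λ ^ 3 * c ^ 2 / 4 + Λ ^ 3 * c ^ 2 := by
          rw [div_one]
          gcongr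
          nlinarith [sq_nonneg c]
      _ = 5 / 4 * (1 / (1024 * Λ ^ 3)) := by rw [hc]; field_simp; norm_num
      _ ≤ 1 / (256 * Λ ^ 3) := by
          have : 1 / (256 * Λ ^ 3) = 4 * (1 / (1024 * Λ ^ 3)) := by field_simp; norm_num
          rw [this]
          gcongr
          norm_num
  · refine e1.trans ?_
    rw [div_le_one (by positivity)]
    nlinarith

/-- Each cell of length `X / Q` costs a multiple of `Q * X * δ = X ^ 3` times one plus its number of
dual points. The ones add up to `δ * Q ^ 2`; the dual points are counted by exchanging the sums over
cells and over dual points. -/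
theorem exists_count_le {Λ α : ℝ} {f g : ℝ → ℝ} (h : UnifConvex Λ f g) (hα : 0 < α) {a b : ℝ}
    (hab : a ≤ b) : ∃ C : ℝ, 0 < C ∧ ∀ (θ : ℝ × ℝ) (Q δ X : ℝ), 1 ≤ Q → 0 < δ → δ ≤ 1 →
      1 ≤ X → X ^ 2 = δ * Q →
      (shiftedCount f (Icc a b) θ Q δ : ℝ) ≤
        C * (δ * Q ^ 2 + X ^ 3 * (1 / δ) * (1 / δ) ^ α) := by
  classical
  have hΛ := h.one_le
  have hΛ0 := h.pos
  obtain ⟨F, G, hFG, hG, hF⟩ := h.exists_dual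
  set n₀ : ℕ := ⌈g b - g a⌉₊ + 1 with hn₀
  have hn₀' : g b - g a + 2 ≤ n₀ + 1 := by
    have := Nat.le_ceil (g b - g a)
    rw [hn₀]; push_cast; linarith
  obtain ⟨K, hK, hsum⟩ := exists_sum_near_le hΛ hα n₀
  set c : ℝ := 1 / (32 * Λ ^ 3) with hc
  have hΛ3 : 1 ≤ Λ ^ 3 := one_le_pow₀ hΛ
  have hc0 : 0 < c := by rw [hc]; positivity
  have hc1 : c ≤ 1 / 32 := by
    rw [hc]
    apply one_div_le_one_div_of_le (by norm_num)
    nlinarith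
  refine ⟨64 * Λ / c ^ 3 * (b - a + 1 + 4 * Λ * c * K), by
    have : 0 ≤ b - a := by linarith
    positivity, ?_⟩
  intro θ Q δ X hQ hδ hδ1 hX hXQ
  have hX0 : 0 < X := by linarith
  have hQ0 : 0 < Q := by linarith
  have hδQ : 1 ≤ δ * Q := by rw [← hXQ]; exact one_le_pow₀ hX
  set ℓ : ℝ := X / Q with hℓ
  have hℓ0 : 0 < ℓ := by positivity
  have hXℓ : X = Q * ℓ := by rw [hℓ]; field_simp
  have hδℓ : δ = X * ℓ := by
    rw [hℓ, ← mul_div_assoc, ← sq, hXQ]; field_simp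
  have hℓ1 : ℓ ≤ 1 := by
    rw [hℓ, div_le_one hQ0]
    nlinarith
  set S : Finset (ℤ × ℕ) := (shiftedRationals_finite f a b θ Q δ).toFinset with hS
  have hcard : shiftedCount f (Icc a b) θ Q δ = S.card :=
    Set.ncard_eq_toFinset_card _ (shiftedRationals_finite f a b θ Q δ)
  have hmem : ∀ z ∈ S, 0 < z.2 ∧ Q < (z.2 : ℝ) ∧ (z.2 : ℝ) ≤ 2 * Q ∧
      ((z.1 : ℝ) + θ.1) / (z.2 : ℝ) ∈ Icc a b ∧
      distNearestInt ((z.2 : ℝ) * f (((z.1 : ℝ) + θ.1) / (z.2 : ℝ)) - θ.2) < δ := by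
    intro z hz
    rw [hS, Set.Finite.mem_toFinset] at hz
    exact hz
  set cell : ℤ × ℕ → ℕ := fun z => ⌊(((z.1 : ℝ) + θ.1) / (z.2 : ℝ) - a) / ℓ⌋₊ with hcell
  set n : ℕ := ⌊(b - a) / ℓ⌋₊ + 1 with hn
  have hba : 0 ≤ (b - a) / ℓ := div_nonneg (by linarith) hℓ0.le
  have hmaps : ∀ z ∈ S, cell z ∈ Finset.range n := by
    intro z hz
    have := (hmem z hz).2.2.2.1.2
    rw [Finset.mem_range, hn, Nat.lt_succ_iff]
    apply Nat.floor_le_floor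
    gcongr
  have hnode : ∀ i ∈ Finset.range n, (a + i * ℓ) ∈ Icc a b := by
    intro i hi
    rw [Finset.mem_range, hn, Nat.lt_succ_iff] at hi
    have h1 : (i : ℝ) ≤ (b - a) / ℓ :=
      (Nat.cast_le.2 hi).trans (Nat.floor_le hba)
    rw [le_div_iff₀ hℓ0] at h1
    refine ⟨?_, by linarith⟩
    have : 0 ≤ (i : ℝ) * ℓ := by positivity
    linarith
  let E : ℕ → Finset (ℤ × ℤ × ℤ) := fun i =>
    (dualBox_finite f g Λ c δ Q X (a + i * ℓ)).toFinset
  have hmemE : ∀ i b, b ∈ E i ↔ b ∈ dualBox f g Λ c δ Q X (a + i * ℓ) := fun i b => by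
    simp [E]
  have hcells : ∀ i ∈ Finset.range n, ((S.filter fun z => cell z = i).card : ℝ) ≤
      64 * Λ / c ^ 3 * (Q * X * δ) * (1 + 2 * ((E i).card : ℝ)) := by
    intro i hi
    refine card_cell_le h hc0 (by linarith) hδ hQ hX hXℓ hδℓ θ _ fun z hz => ?_
    obtain ⟨hzS, hzi⟩ := Finset.mem_filter.1 hz
    obtain ⟨z1, z2, z3, z4, z5⟩ := hmem z hzS
    have hnn : 0 ≤ (((z.1 : ℝ) + θ.1) / (z.2 : ℝ) - a) / ℓ :=
      div_nonneg (by linarith [z4.1]) hℓ0.le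
    have f1 := Nat.floor_le hnn
    have f2 := Nat.lt_floor_add_one ((((z.1 : ℝ) + θ.1) / (z.2 : ℝ) - a) / ℓ)
    have f3 : ⌊(((z.1 : ℝ) + θ.1) / (z.2 : ℝ) - a) / ℓ⌋₊ = i := hzi
    rw [f3, le_div_iff₀ hℓ0] at f1
    rw [f3, div_lt_iff₀ hℓ0] at f2
    exact ⟨z1, z2, z3, by linarith, by linarith, z5⟩
  set T : Finset (ℤ × ℤ × ℤ) := (Finset.range n).biUnion E with hT
  have hdual : ∑ i ∈ Finset.range n, ((E i).card : ℝ) ≤ 2 * Λ * c * K * (1 / δ) * (1 / δ) ^ α := by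
    have hswap : ∑ i ∈ Finset.range n, ((E i).card : ℝ) =
        ∑ d ∈ T, (((Finset.range n).filter fun i => d ∈ E i).card : ℝ) := by
      have h1 : ∀ i ∈ Finset.range n, ((E i).card : ℝ) = ∑ d ∈ T, if d ∈ E i then (1 : ℝ) else 0 := by
        intro i hi
        rw [Finset.sum_boole]
        congr 2
        ext d
        simp only [Finset.mem_filter, hT, Finset.mem_biUnion]
        exact ⟨fun hd => ⟨⟨i, hi, hd⟩, hd⟩, fun hd => hd.2⟩
      rw [Finset.sum_congr rfl h1, Finset.sum_comm]
      refine Finset.sum_congr rfl fun d _ => ?_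
      rw [Finset.sum_boole]
    -- The nodes seeing `d` are `ℓ`-separated and all close to the same point `G (d.2.1 / d.1)`. The
    -- height bound `d.1 ≤ c / (2 * Λ * δ)` absorbs the additive one.
    have hcount : ∀ d ∈ T, (((Finset.range n).filter fun i => d ∈ E i).card : ℝ) ≤
        2 * Λ * c / δ * (1 / (d.1 : ℝ)) := by
      intro d hd
      obtain ⟨i₀, -, hdi₀⟩ := Finset.mem_biUnion.1 hd
      have hd₀ := (hmemE _ _).1 hdi₀
      have hd0 : (0 : ℝ) < d.1 := by exact_mod_cast hd₀.1
      have hw : 0 ≤ Λ * c / (X * d.1) := by positivity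
      have hsepc := card_le_of_separated ((Finset.range n).filter fun i => d ∈ E i)
        (fun i => a + i * ℓ) (s := ℓ) (w := Λ * c / (X * d.1)) hℓ0 hw
        (fun i _ j _ hij => ?_) (fun i hi j hj => ?_)
      · refine hsepc.trans ?_
        have e1 : Λ * c / (X * d.1) / ℓ = Λ * c / (δ * d.1) := by
          rw [hδℓ, div_div]; congr 1; ring
        have e2 : 1 ≤ c / (2 * Λ * δ) / d.1 := by
          rw [le_div_iff₀ hd0, one_mul]; exact hd₀.2.1
        have e3 : c / (2 * Λ * δ) / d.1 ≤ Λ * c / (δ * d.1) := by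
          rw [div_div, div_le_div_iff₀ (by positivity) (by positivity)]
          have : c * (δ * d.1) ≤ Λ * c * (2 * Λ) * (δ * d.1) := by
            gcongr
            nlinarith [mul_le_mul hΛ hΛ zero_le_one hΛ0.le]
          linarith
        have e4 : 2 * Λ * c / δ * (1 / (d.1 : ℝ)) = 2 * (Λ * c / (δ * d.1)) := by
          field_simp
        rw [e1, e4]
        linarith
      · rw [add_sub_add_left_eq_sub, ← sub_mul, abs_mul, abs_of_pos hℓ0]
        have : (1 : ℝ) ≤ |(i : ℝ) - j| := by
          have : (i : ℤ) - j ≠ 0 := by omega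
          exact_mod_cast Int.one_le_abs this
        nlinarith
      · have b1 := (dualBox_isNear h hG hF hc hδ hQ0 hX hδQ
          ((hmemE _ _).1 (Finset.mem_filter.1 hi).2)).2.2
        have b2 := (dualBox_isNear h hG hF hc hδ hQ0 hX hδQ
          ((hmemE _ _).1 (Finset.mem_filter.1 hj).2)).2.2
        have b3 := abs_sub_le (a + i * ℓ) (G ((d.2.1 : ℝ) / d.1)) (a + j * ℓ)
        rw [abs_sub_comm (G _)] at b3
        have b4 : Λ * c / (X * d.1) = Λ * c / (2 * X * d.1) + Λ * c / (2 * X * d.1) := by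
          field_simp; norm_num
        rw [b4]
        linarith
    have hTsum := hsum F G hFG (g a - 1) (1 / δ) (by rw [le_div_iff₀ hδ]; linarith) T
      (fun d hd => by
        obtain ⟨i, hi, hdi⟩ := Finset.mem_biUnion.1 hd
        have hd₀ := (hmemE _ _).1 hdi
        obtain ⟨n1, n2, -⟩ := dualBox_isNear h hG hF hc hδ hQ0 hX hδQ hd₀
        obtain ⟨m1, m2⟩ := hnode i hi
        have g1 := h.mono m1
        have g2 := h.mono m2
        rw [abs_le] at n2
        refine ⟨n1, hd₀.2.1.trans ?_, by linarith, by linarith⟩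
        rw [div_le_div_iff₀ (by positivity) hδ]
        nlinarith)
    rw [hswap]
    calc _ ≤ ∑ d ∈ T, 2 * Λ * c / δ * (1 / (d.1 : ℝ)) := Finset.sum_le_sum hcount
      _ = 2 * Λ * c / δ * ∑ d ∈ T, 1 / (d.1 : ℝ) := by rw [Finset.mul_sum]
      _ ≤ 2 * Λ * c / δ * (K * (1 / δ) ^ α) := by gcongr
      _ = _ := by ring
  have hnℓ : (n : ℝ) ≤ (b - a + 1) / ℓ := by
    have h1 := Nat.floor_le hba
    have h2 : 1 ≤ 1 / ℓ := by rwa [one_le_div hℓ0]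
    rw [hn, add_div]; push_cast; linarith
  rw [hcard, Finset.card_eq_sum_card_fiberwise hmaps]
  push_cast
  have hA : 0 ≤ 64 * Λ / c ^ 3 * (Q * X * δ) := by positivity
  calc _ ≤ ∑ i ∈ Finset.range n, 64 * Λ / c ^ 3 * (Q * X * δ) * (1 + 2 * ((E i).card : ℝ)) :=
        Finset.sum_le_sum hcells
    _ = 64 * Λ / c ^ 3 * (Q * X * δ) * (n + 2 * ∑ i ∈ Finset.range n, ((E i).card : ℝ)) := by
        rw [← Finset.mul_sum, Finset.sum_add_distrib, ← Finset.mul_sum]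
        simp
    _ ≤ 64 * Λ / c ^ 3 * (Q * X * δ) *
        ((b - a + 1) / ℓ + 2 * (2 * Λ * c * K * (1 / δ) * (1 / δ) ^ α)) := by gcongr
    _ = 64 * Λ / c ^ 3 * ((b - a + 1) * (Q * X * δ / ℓ) +
        4 * Λ * c * K * (X * (δ * Q) * (1 / δ) * (1 / δ) ^ α)) := by ring
    _ = 64 * Λ / c ^ 3 * ((b - a + 1) * (δ * Q ^ 2) +
        4 * Λ * c * K * (X ^ 3 * (1 / δ) * (1 / δ) ^ α)) := by
        have h1 : Q * X * δ / ℓ = δ * Q ^ 2 := by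
          rw [hℓ]; field_simp
        rw [h1, ← hXQ]; ring
    _ ≤ _ := by
        rw [mul_assoc (64 * Λ / c ^ 3) (b - a + 1 + 4 * Λ * c * K)]
        gcongr
        have p1 : 0 ≤ δ * Q ^ 2 := by positivity
        have p2 : 0 ≤ X ^ 3 * (1 / δ) * (1 / δ) ^ α := by positivity
        have p3 : 0 ≤ 4 * Λ * c * K := by positivity
        have p4 : 0 ≤ b - a + 1 := by linarith
        nlinarith [mul_nonneg p3 p1, mul_nonneg p4 p2]

/-! ### Symmetries of the count and reduction to uniformly convex functions. -/

theorem distNearestInt_neg (x : ℝ) : distNearestInt (-x) = distNearestInt x := by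
  have key : ∀ y : ℝ, distNearestInt (-y) ≤ distNearestInt y := by
    intro y
    have h := round_le (-y) (-round y)
    unfold distNearestInt
    refine h.trans_eq ?_
    push_cast
    rw [← abs_neg]
    congr 1
    ring
  refine le_antisymm (key x) ?_
  simpa using key (-x)

theorem shiftedCount_neg (f : ℝ → ℝ) (I : Set ℝ) (θ : ℝ × ℝ) (Q δ : ℝ) :
    shiftedCount (-f) I (θ.1, -θ.2) Q δ = shiftedCount f I θ Q δ := by
  unfold shiftedCount shiftedRationals
  congr 1
  ext z
  simp only [mem_ofPred_eq, Pi.neg_apply]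
  rw [← distNearestInt_neg ((z.2 : ℝ) * f (((z.1 : ℝ) + θ.1) / (z.2 : ℝ)) - θ.2)]
  ring_nf

theorem shiftedCount_congr {f F : ℝ → ℝ} {I : Set ℝ} (h : EqOn f F I) (θ : ℝ × ℝ) (Q δ : ℝ) :
    shiftedCount f I θ Q δ = shiftedCount F I θ Q δ := by
  unfold shiftedCount shiftedRationals
  congr 1
  ext z
  simp only [mem_ofPred_eq]
  refine and_congr_right fun _ => and_congr_right fun _ => and_congr_right fun _ =>
    and_congr_right fun hz => ?_
  rw [h hz]

theorem shiftedCount_mono (f : ℝ → ℝ) (a b : ℝ) (θ : ℝ × ℝ) (Q : ℝ) {δ δ' : ℝ} (h : δ ≤ δ') :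
    shiftedCount f (Icc a b) θ Q δ ≤ shiftedCount f (Icc a b) θ Q δ' :=
  Set.ncard_le_ncard (fun _ hz => ⟨hz.1, hz.2.1, hz.2.2.1, hz.2.2.2.1, hz.2.2.2.2.trans_le h⟩)
    (shiftedRationals_finite f a b θ Q δ')

/-- A function with a Lipschitz, strongly increasing derivative is uniformly convex. -/
theorem unifConvex_of_hasDerivAt {Λ : ℝ} {f g : ℝ → ℝ} (hΛ : 1 ≤ Λ)
    (hd : ∀ x, HasDerivAt f (g x) x) (hlo : ∀ x y, x ≤ y → y - x ≤ Λ * (g y - g x))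
    (hup : ∀ x y, x ≤ y → g y - g x ≤ Λ * (y - x)) : UnifConvex Λ f g := by
  refine ⟨hΛ, fun x y => ?_, hlo, hup⟩
  have hmono : ∀ x y, x ≤ y → g x ≤ g y := by
    intro x y hxy
    have := hlo x y hxy
    by_contra! hc
    nlinarith
  have hcont : ∀ s, ContinuousOn f s := fun s x _ => (hd x).continuousAt.continuousWithinAt
  rcases lt_trichotomy x y with hxy | rfl | hxy
  · obtain ⟨z, ⟨hz1, -⟩, hz⟩ := exists_hasDerivAt_eq_slope f g hxy (hcont _) fun z _ => hd z
    rw [eq_div_iff (sub_pos.2 hxy).ne'] at hz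
    have := hmono x z hz1.le
    nlinarith
  · simp
  · obtain ⟨z, ⟨-, hz1⟩, hz⟩ := exists_hasDerivAt_eq_slope f g hxy (hcont _) fun z _ => hd z
    rw [eq_div_iff (sub_pos.2 hxy).ne'] at hz
    have := hmono z x hz1.le
    nlinarith

/-- The derivative is continued with slope one beyond both endpoints, by clamping `x` to the
interval, and then integrated. `Λ` dominates `1`, the maximum of the second derivative and the
inverse of its minimum. -/
theorem exists_unifConvex_extension {a b : ℝ} (hab : a < b) {f : ℝ → ℝ}
    (hf : ContDiffOn ℝ 2 f (Icc a b))
    (hpos : ∀ x ∈ Icc a b, 0 < iteratedDerivWithin 2 f (Icc a b) x) :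
    ∃ (Λ : ℝ) (F g : ℝ → ℝ), UnifConvex Λ F g ∧ EqOn f F (Icc a b) := by
  set s := Icc a b with hs
  have hu : UniqueDiffOn ℝ s := uniqueDiffOn_Icc hab
  set d := derivWithin f s with hd
  have hd1 : ContDiffOn ℝ 1 d s := hf.derivWithin hu (by norm_num)
  have hdc : ContinuousOn d s := hd1.continuousOn
  have h2 : iteratedDerivWithin 2 f s = derivWithin d s := by
    rw [iteratedDerivWithin_succ', iteratedDerivWithin_one]
  have hc2 : ContinuousOn (iteratedDerivWithin 2 f s) s :=
    hf.continuousOn_iteratedDerivWithin le_rfl hu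
  have hne : s.Nonempty := nonempty_Icc.2 hab.le
  obtain ⟨x₀, hx₀, hmin⟩ := isCompact_Icc.exists_isMinOn hne hc2
  obtain ⟨x₁, hx₁, hmax⟩ := isCompact_Icc.exists_isMaxOn hne hc2
  set m := iteratedDerivWithin 2 f s x₀ with hm
  set M := iteratedDerivWithin 2 f s x₁ with hM
  have hm0 : 0 < m := hpos x₀ hx₀
  have hM0 : 0 < M := hpos x₁ hx₁
  have hderiv : ∀ x ∈ interior s, deriv d x = iteratedDerivWithin 2 f s x := by
    intro x hx
    rw [h2, derivWithin_of_mem_nhds (mem_interior_iff_mem_nhds.1 hx)]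
  have hddiff : DifferentiableOn ℝ d (interior s) :=
    (hd1.differentiableOn one_ne_zero).mono interior_subset
  have hlo : ∀ x ∈ s, ∀ y ∈ s, x ≤ y → m * (y - x) ≤ d y - d x :=
    (convex_Icc a b).mul_sub_le_image_sub_of_le_deriv hdc hddiff fun x hx => by
      rw [hderiv x hx]; exact hmin (interior_subset hx)
  have hhi : ∀ x ∈ s, ∀ y ∈ s, x ≤ y → d y - d x ≤ M * (y - x) :=
    (convex_Icc a b).image_sub_le_mul_sub_of_deriv_le hdc hddiff fun x hx => by
      rw [hderiv x hx]; exact hmax (interior_subset hx)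
  let c : ℝ → ℝ := fun x => max a (min b x)
  have hcs : ∀ x, c x ∈ s := fun x => ⟨le_max_left _ _, max_le hab.le (min_le_left _ _)⟩
  have hcc : Continuous c := by fun_prop
  have hcid : ∀ x ∈ s, c x = x := by
    intro x hx
    simp only [c]
    rw [min_eq_right hx.2, max_eq_right hx.1]
  have hcmono : ∀ x y, x ≤ y → c x ≤ c y := by
    intro x y hxy
    simp only [c]
    gcongr
  have hcsub : ∀ x y, x ≤ y → x - c x ≤ y - c y := by
    intro x y hxy
    simp only [c]
    rcases max_cases a (min b x) with h | h <;> rcases max_cases a (min b y) with h' | h' <;>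
      rcases min_cases b x with k | k <;> rcases min_cases b y with k' | k' <;> linarith
  let g : ℝ → ℝ := fun x => d (c x) + (x - c x)
  have hgc : Continuous g := by
    have : Continuous fun x => d (c x) := hdc.comp_continuous hcc hcs
    exact this.add (continuous_id.sub hcc)
  let F : ℝ → ℝ := fun x => f a + ∫ t in a..x, g t
  have hFd : ∀ x, HasDerivAt F (g x) x := fun x =>
    (hgc.integral_hasStrictDerivAt a x).hasDerivAt.const_add (f a)
  have hmi : 0 < 1 / m := by positivity
  refine ⟨1 + M + 1 / m, F, g, unifConvex_of_hasDerivAt (by linarith) hFd (fun x y hxy => ?_)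
    (fun x y hxy => ?_), fun x hx => ?_⟩
  · have e1 := hlo _ (hcs x) _ (hcs y) (hcmono x y hxy)
    have e2 := hcmono x y hxy
    have e3 := hcsub x y hxy
    have e4 : (1 / m) * (m * (c y - c x)) ≤ (1 / m) * (d (c y) - d (c x)) := by gcongr
    have e5 : (1 / m) * (m * (c y - c x)) = c y - c x := by field_simp
    have e6 : 0 ≤ d (c y) - d (c x) := le_trans (mul_nonneg hm0.le (by linarith)) e1
    have e7 : 0 ≤ (1 + M) * (d (c y) - d (c x)) := by positivity
    have e8 : 0 ≤ (M + 1 / m) * ((y - c y) - (x - c x)) :=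
      mul_nonneg (by positivity) (by linarith)
    simp only [g]
    linarith
  · have e1 := hhi _ (hcs x) _ (hcs y) (hcmono x y hxy)
    have e2 := hcmono x y hxy
    have e3 := hcsub x y hxy
    have e7 : 0 ≤ (1 + 1 / m) * (c y - c x) := mul_nonneg (by positivity) (by linarith)
    have e8 : 0 ≤ (M + 1 / m) * ((y - c y) - (x - c x)) :=
      mul_nonneg (by positivity) (by linarith)
    simp only [g]
    linarith
  · have hsub : Icc a x ⊆ s := Icc_subset_Icc_right hx.2
    have := intervalIntegral.integral_eq_sub_of_hasDerivAt_of_le hx.1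
      (hf.continuousOn.mono hsub) (f' := g) (fun t ht => ?_) (hgc.intervalIntegrable a x)
    · simp only [F]
      rw [this]; ring
    · have hts : s ∈ nhds t := Icc_mem_nhds ht.1 (ht.2.trans_le hx.2)
      have htm : t ∈ s := mem_of_mem_nhds hts
      have h3 : HasDerivWithinAt f (d t) s t :=
        ((hf.differentiableOn two_ne_zero) t htm).hasDerivWithinAt
      have h4 : g t = d t := by simp only [g]; rw [hcid t htm]; ring
      rw [h4]
      exact h3.hasDerivAt hts

/-! ### Choice of exponents and conclusion. -/

theorem exists_count_le_of_pos {a b : ℝ} (hab : a < b) {f : ℝ → ℝ}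
    (hf : ContDiffOn ℝ 2 f (Icc a b))
    (hpos : ∀ x ∈ Icc a b, 0 < iteratedDerivWithin 2 f (Icc a b) x) {w : ℝ} (hw : 0 < w)
    (hw1 : w < 1) : ∃ C : ℝ, 0 < C ∧ ∀ (θ : ℝ × ℝ) (Q δ : ℝ), 1 ≤ Q → 0 < δ → δ ≤ 1 / 2 →
      (shiftedCount f (Icc a b) θ Q δ : ℝ) ≤
        C * (δ * Q ^ 2 + δ ^ ((w - 1) / 2) * Q ^ ((3 - w) / 2)) := by
  obtain ⟨Λ, F, g, hFg, heq⟩ := exists_unifConvex_extension hab hf hpos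
  have hw3 : 0 < 3 - w := by linarith
  have hw1' : 0 < 1 + w := by linarith
  -- At `δ = Q ^ (-γ)` the two terms of the bound coincide; `α` solves `γ * (1 + 2 * α) = 1`, which
  -- is exactly what `X * (1 / δ) ^ (1 + α) ≤ Q` requires there.
  set γ : ℝ := (1 + w) / (3 - w) with hγ
  set α : ℝ := (1 - w) / (1 + w) with hα
  have hα0 : 0 < α := div_pos (by linarith) hw1'
  have hγ0 : 0 < γ := by positivity
  have hγ1 : γ ≤ 1 := by rw [hγ, div_le_one hw3]; linarith
  have hγα : γ * (1 + 2 * α) = 1 := by rw [hγ, hα]; field_simp; ring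
  obtain ⟨C, hC, hmain⟩ := exists_count_le hFg hα0 hab.le
  have hlarge : ∀ (θ : ℝ × ℝ) (Q δ : ℝ), 1 ≤ Q → Q ^ (-γ) ≤ δ → δ ≤ 1 →
      (shiftedCount f (Icc a b) θ Q δ : ℝ) ≤ 2 * C * (δ * Q ^ 2) := by
    intro θ Q δ hQ hδQ hδ1
    have hQ0 : 0 < Q := by linarith
    have hδ : 0 < δ := (Real.rpow_pos_of_pos hQ0 _).trans_le hδQ
    have hδQ1 : 1 ≤ δ * Q := by
      calc 1 = Q ^ (-1 : ℝ) * Q := by rw [Real.rpow_neg_one]; field_simp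
        _ ≤ Q ^ (-γ) * Q := by
            gcongr
        _ ≤ _ := by gcongr
    set X := √(δ * Q) with hX
    have hX1 : 1 ≤ X := Real.one_le_sqrt.2 hδQ1
    have hX2 : X ^ 2 = δ * Q := Real.sq_sqrt (by positivity)
    rw [shiftedCount_congr heq]
    refine (hmain θ Q δ X hQ hδ hδ1 hX1 hX2).trans ?_
    have hD : 1 / δ ≤ Q ^ γ := by
      rw [Real.rpow_neg hQ0.le] at hδQ
      rw [one_div]
      exact inv_le_of_inv_le₀ (by positivity) hδQ
    have hD0 : 0 < 1 / δ := by positivity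
    have hXD : X * ((1 / δ) * (1 / δ) ^ α) ≤ Q := by
      refine le_of_sq_le_sq ?_ hQ0.le
      have e1 : ((1 / δ) ^ α) ^ 2 * (1 / δ) = (1 / δ) ^ (1 + 2 * α) := by
        rw [Real.rpow_add hD0, Real.rpow_one, mul_comm 2 α, Real.rpow_mul hD0.le,
          Real.rpow_two, mul_comm]
      calc (X * ((1 / δ) * (1 / δ) ^ α)) ^ 2
          = X ^ 2 * (1 / δ) * (((1 / δ) ^ α) ^ 2 * (1 / δ)) := by ring
        _ = Q * (1 / δ) ^ (1 + 2 * α) := by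
            rw [e1, hX2]; field_simp
        _ ≤ Q * (Q ^ γ) ^ (1 + 2 * α) := by gcongr
        _ = Q ^ 2 := by rw [← Real.rpow_mul hQ0.le, hγα, Real.rpow_one, sq]
    have hfin : X ^ 3 * (1 / δ) * (1 / δ) ^ α ≤ δ * Q ^ 2 := by
      calc X ^ 3 * (1 / δ) * (1 / δ) ^ α = X ^ 2 * (X * ((1 / δ) * (1 / δ) ^ α)) := by ring
        _ ≤ X ^ 2 * Q := by gcongr
        _ = δ * Q ^ 2 := by rw [hX2]; ring
    calc _ ≤ C * (δ * Q ^ 2 + δ * Q ^ 2) := by gcongr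
      _ = _ := by ring
  refine ⟨2 * C, by positivity, fun θ Q δ hQ hδ hδ2 => ?_⟩
  have hQ0 : 0 < Q := by linarith
  rcases le_total (Q ^ (-γ)) δ with h | h
  · refine (hlarge θ Q δ hQ h (by linarith)).trans ?_
    gcongr
    have : 0 ≤ δ ^ ((w - 1) / 2) * Q ^ ((3 - w) / 2) := by positivity
    linarith
  -- Below the threshold the count is at most its value at `Q ^ (-γ)`, and the second term only
  -- grows as `δ` decreases.
  · have h1 : Q ^ (-γ) ≤ 1 := Real.rpow_le_one_of_one_le_of_nonpos hQ (by linarith)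
    have hmono : (shiftedCount f (Icc a b) θ Q δ : ℝ) ≤
        shiftedCount f (Icc a b) θ Q (Q ^ (-γ)) := by
      exact_mod_cast shiftedCount_mono f a b θ Q h
    refine (hmono.trans (hlarge θ Q _ hQ le_rfl h1)).trans ?_
    gcongr
    have h2 : (Q ^ (-γ)) ^ ((w - 1) / 2) ≤ δ ^ ((w - 1) / 2) :=
      Real.rpow_le_rpow_of_nonpos hδ h (by linarith)
    have h3 : Q ^ (-γ) * Q ^ 2 = (Q ^ (-γ)) ^ ((w - 1) / 2) * Q ^ ((3 - w) / 2) := by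
      rw [← Real.rpow_mul hQ0.le, ← Real.rpow_add hQ0, ← Real.rpow_natCast Q 2,
        ← Real.rpow_add hQ0]
      congr 1
      rw [hγ]
      push_cast
      field_simp
      ring
    rw [h3]
    have : (Q ^ (-γ)) ^ ((w - 1) / 2) * Q ^ ((3 - w) / 2) ≤
        δ ^ ((w - 1) / 2) * Q ^ ((3 - w) / 2) := by gcongr
    have : 0 ≤ δ * Q ^ 2 := by positivity
    linarith

theorem pos_or_neg_of_ne_zero {s : Set ℝ} (hs : IsPreconnected s) {u : ℝ → ℝ}
    (hu : ContinuousOn u s) (h0 : ∀ x ∈ s, u x ≠ 0) :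
    (∀ x ∈ s, 0 < u x) ∨ ∀ x ∈ s, u x < 0 := by
  by_contra! h
  obtain ⟨⟨x, hx, hx0⟩, y, hy, hy0⟩ := h
  obtain ⟨z, hz, hz0⟩ := hs.intermediate_value hx hy hu ⟨hx0, hy0⟩
  exact h0 z hz hz0

theorem mainTheorem4 (a b : ℝ) (hab : a < b) (f : ℝ → ℝ)
    (hf : ContDiffOn ℝ 2 f (Icc a b))
    (hf_ne : ∀ x ∈ Icc a b, iteratedDerivWithin 2 f (Icc a b) x ≠ 0)
    (φ : ℝ≥0) (hφ_pos : 0 < φ) (hφ_lt : φ < 1)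
    (hLip : ∃ K : ℝ≥0, HolderOnWith K φ (iteratedDerivWithin 2 f (Icc a b)) (Icc a b))
    (ε : ℝ) (hε : 0 < ε) :
    ∃ C : ℝ, 0 < C ∧ ∀ (θ : ℝ × ℝ) (Q δ : ℝ), 1 ≤ Q → 0 < δ → δ ≤ 1 / 2 →
      (shiftedCount f (Icc a b) θ Q δ : ℝ) ≤
        C * (δ * Q ^ 2 + δ ^ (-(1 / 2) : ℝ) * Q ^ (1 / 2 + ε : ℝ) +
          δ ^ (((φ : ℝ) - 1) / 2) * Q ^ ((3 - (φ : ℝ)) / 2)) := by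
  have hu : UniqueDiffOn ℝ (Icc a b) := uniqueDiffOn_Icc hab
  suffices h : ∃ C : ℝ, 0 < C ∧ ∀ (θ : ℝ × ℝ) (Q δ : ℝ), 1 ≤ Q → 0 < δ → δ ≤ 1 / 2 →
      (shiftedCount f (Icc a b) θ Q δ : ℝ) ≤
        C * (δ * Q ^ 2 + δ ^ (((φ : ℝ) - 1) / 2) * Q ^ ((3 - (φ : ℝ)) / 2)) by
    obtain ⟨C, hC, h⟩ := h
    refine ⟨C, hC, fun θ Q δ hQ hδ hδ2 => (h θ Q δ hQ hδ hδ2).trans ?_⟩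
    gcongr
    have : 0 ≤ δ ^ (-(1 / 2) : ℝ) * Q ^ (1 / 2 + ε : ℝ) := by positivity
    linarith
  have hφ0 : (0 : ℝ) < φ := by exact_mod_cast hφ_pos
  have hφ1 : (φ : ℝ) < 1 := by exact_mod_cast hφ_lt
  rcases pos_or_neg_of_ne_zero isPreconnected_Icc
    (hf.continuousOn_iteratedDerivWithin le_rfl hu) hf_ne with h | h
  · exact exists_count_le_of_pos hab hf h hφ0 hφ1
  -- The concave case is the convex one for `-f`, with `θ.2` replaced by `-θ.2`; this is harmless
  -- because the bound is uniform in `θ`.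
  · obtain ⟨C, hC, hneg⟩ := exists_count_le_of_pos hab hf.neg (fun x hx => by
      have : iteratedDerivWithin 2 (-f) (Icc a b) x = -iteratedDerivWithin 2 f (Icc a b) x :=
        iteratedDerivWithin_neg f
      change 0 < iteratedDerivWithin 2 (-f) (Icc a b) x
      rw [this]
      linarith [h x hx]) hφ0 hφ1
    refine ⟨C, hC, fun θ Q δ hQ hδ hδ2 => ?_⟩
    rw [← shiftedCount_neg]
    exact hneg _ Q δ hQ hδ hδ2
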